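/- Let $H\in[-\infty,1/2]$ and let $T=\bigcup_{n\ge 0}\{0,1\}^n$ be the set of finite binary words. Let $(\epsilon(w))_{w\in T}$ be independent, identically distributed random variables taking the values $1$ and $-1$ with respective probabilities $(1+2^{H-1})/2$ and $(1-2^{H-1})/2$, where $2^{-\infty}=0$. For $n\ge 1$ and $w=w_1\cdots w_n\in\{0,1\}^n$ put $\boldsymbol{\epsilon}(w)=\prod_{k=1}^n\epsilon(w_1\cdots w_k)$. For $0\le k<2^n$ let $\xi^{(n)}_k=\boldsymbol{\epsilon}(w)$, where $w$ is the unique word in $\{0,1\}^n$ with $\sum_{i=1}^n w_i2^{-i}=k2^{-n}$, and let $S^{(n)}_r=\sum_{k=0}^{r-1}\xi^{(n)}_k$ for $0\le r\le 2^n$. For $t\in[0,1]$ let $$L_n(t)=S^{(n)}_{[2^nt]}+(2^nt-[2^nt])\,\xi^{(n)}_{[2^nt]}$$ (the last term being $0$ at $t=1$). For $H>-\infty$ let $B_n(t)=2^{-nH}L_n(t)$, and let $\sigma=\sqrt{1+(2^{2-2H}-2)^{-1}}$ if $H<1/2$ and $\sigma=1/\sqrt2$ if $H=1/2$. Define $$X_n=\frac{B_n}{\sigma\,2^{n(1/2-H)}}\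 \text{ if } -\infty<H<1/2,\qquad X_n=\frac{B_n}{\sigma\sqrt n}\ \text{ if } H=1/2,\qquad X_n=2^{-n/2}L_n\ \text{ if } H=-\infty.$$ Then, as $n\to\infty$, the sequence of continuous processes $(X_n)_{n\ge1}$ converges in law in $\mathcal{C}([0,1])$, endowed with the uniform norm, to the restriction to $[0,1]$ of the standard Brownian motion. -/

import Mathlib

open MeasureTheory ProbabilityTheory Filter Topology

noncomputable section

namespace SignedCascade

/-- The space `C([0,1])`, whose topology is that of the uniform norm, carries its Borel
`σ`-algebra. -/
instance instMeasurableSpacePaths : MeasurableSpace C(unitInterval, ℝ) := borel _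

instance instBorelSpacePaths : BorelSpace C(unitInterval, ℝ) := ⟨rfl⟩

/-! ### The random signs -/

/-- `2 ^ (H - 1)`, the mean of a sign `ε`, for `H ∈ [-∞, 1/2]`; it is `0` at `H = -∞`.
(The value at `H = +∞` is irrelevant.) -/
def signMean (H : EReal) : ℝ :=
  if H = ⊥ then 0 else (2 : ℝ) ^ (H.toReal - 1)

/-- The law of a sign `ε`: it takes the values `1` and `-1` with respective probabilities
`(1 + 2 ^ (H - 1)) / 2` and `(1 - 2 ^ (H - 1)) / 2`. -/
def signLaw (H : EReal) : Measure ℝ :=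
  ENNReal.ofReal ((1 + signMean H) / 2) • Measure.dirac 1 +
    ENNReal.ofReal ((1 - signMean H) / 2) • Measure.dirac (-1)

/-! ### Words and dyadic points

A node `w = w₁ ⋯ wₙ` of the binary tree is the list `[w₁, …, wₙ]` of its digits
(`false` is the digit `0` and `true` the digit `1`); the empty list is the root. -/

/-- `t_w = ∑ wᵢ 2⁻ⁱ`, the left end point of the dyadic interval encoded by `w`. -/
def dyadicPoint (w : List Bool) : ℝ :=
  ∑ i : Fin w.length, (if w.get i then 1 else 0) * (2 : ℝ)⁻¹ ^ ((i : ℕ) + 1)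

/-- The word of length `n` made of the `n` lowest binary digits of `k`, the most significant one
coming first. For `k < 2 ^ n` it is the word `w` of length `n` with `t_w = k / 2 ^ n`
(see `dyadicPoint_dyadicWord`). -/
def dyadicWord : ℕ → ℕ → List Bool
  | 0, _ => []
  | n + 1, k => k.testBit n :: dyadicWord n k

theorem length_dyadicWord (n k : ℕ) : (dyadicWord n k).length = n := by
  induction n with
  | zero => rfl
  | succ n ih => simp [dyadicWord, ih]

theorem dyadicPoint_cons (b : Bool) (w : List Bool) :
    dyadicPoint (b :: w) = ((if b then 1 else 0) + dyadicPoint w) / 2 := by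
  have h0 : dyadicPoint (b :: w) = (if b then 1 else 0) * (2 : ℝ)⁻¹ ^ (0 + 1) +
      ∑ i : Fin w.length, (if w.get i then 1 else 0) * (2 : ℝ)⁻¹ ^ ((i : ℕ) + 1 + 1) :=
    Fin.sum_univ_succ (n := w.length) _
  rw [h0, add_div, dyadicPoint, Finset.sum_div]
  congr 1
  · split_ifs <;> norm_num
  · refine Finset.sum_congr rfl fun i _ => ?_
    rw [pow_succ _ ((i : ℕ) + 1)]
    ring

theorem dyadicPoint_dyadicWord_mod (n k : ℕ) :
    dyadicPoint (dyadicWord n k) = ((k % 2 ^ n : ℕ) : ℝ) / 2 ^ n := by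
  induction n with
  | zero =>
    have h0 : dyadicPoint [] = 0 := Finset.sum_eq_zero fun i _ => i.elim0
    simp [dyadicWord, h0, Nat.mod_one]
  | succ n ih =>
    rw [dyadicWord, dyadicPoint_cons, ih, Nat.mod_pow_succ, Nat.testBit_eq_decide_div_mod_eq]
    rcases Nat.mod_two_eq_zero_or_one (k / 2 ^ n) with h | h <;> simp [h] <;> field_simp <;> ring

/-- For `k < 2 ^ n`, `dyadicWord n k` is the word `w` of length `n` with `t_w = k 2⁻ⁿ`. -/
theorem dyadicPoint_dyadicWord {n k : ℕ} (hk : k < 2 ^ n) :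
    dyadicPoint (dyadicWord n k) = (k : ℝ) / 2 ^ n := by
  rw [dyadicPoint_dyadicWord_mod, Nat.mod_eq_of_lt hk]

/-! ### The correlated random walk

Here `e : List Bool → ℝ` is a realization `(ε(w))_w` of the signs. -/

/-- The product `ε(w₁) ε(w₁ w₂) ⋯ ε(w₁ ⋯ wₙ)` along the word `w = w₁ ⋯ wₙ`. -/
def signProd (e : List Bool → ℝ) (w : List Bool) : ℝ :=
  ∏ k ∈ Finset.range w.length, e (w.take (k + 1))

/-- The step `ξ_k^{(n)}`, for `0 ≤ k < 2 ^ n`. -/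
def step (e : List Bool → ℝ) (n k : ℕ) : ℝ :=
  signProd e (dyadicWord n k)

/-- The random walk `S_r^{(n)} = ∑_{k < r} ξ_k^{(n)}`. -/
def walk (e : List Bool → ℝ) (n r : ℕ) : ℝ :=
  ∑ k ∈ Finset.range r, step e n k

/-- The linear interpolation `S_{[2ⁿ t]}^{(n)} + (2ⁿ t - [2ⁿ t]) ξ_{[2ⁿ t]}^{(n)}` of the walk.
(At `t = 1`, the factor of `ξ` is `0`.) -/
def interpFun (e : List Bool → ℝ) (n : ℕ) (t : ℝ) : ℝ :=
  walk e n ⌊2 ^ n * t⌋₊ + (2 ^ n * t - ⌊2 ^ n * t⌋₊) * step e n ⌊2 ^ n * t⌋₊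

theorem interpFun_eq_sum (e : List Bool → ℝ) (n : ℕ) {t : ℝ} (h0 : 0 ≤ t) (h1 : t ≤ 1) :
    interpFun e n t =
      ∑ k ∈ Finset.range (2 ^ n + 1), max 0 (min 1 (2 ^ n * t - k)) * step e n k := by
  unfold interpFun walk
  set x : ℝ := 2 ^ n * t with hx
  have hx0 : 0 ≤ x := by positivity
  set m := ⌊x⌋₊ with hm
  have hmx : (m : ℝ) ≤ x := Nat.floor_le hx0
  have hxm : x < m + 1 := Nat.lt_floor_add_one x
  have hmn : m ≤ 2 ^ n := by
    have : (m : ℝ) ≤ ((2 ^ n : ℕ) : ℝ) := by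
      push_cast
      exact hmx.trans (mul_le_of_le_one_right (by positivity) h1)
    exact_mod_cast this
  have hsub : Finset.range (m + 1) ⊆ Finset.range (2 ^ n + 1) :=
    Finset.range_subset_range.2 (by omega)
  rw [← Finset.sum_subset hsub, Finset.sum_range_succ]
  · congr 1
    · refine Finset.sum_congr rfl fun k hk => ?_
      have hkm : (k : ℝ) + 1 ≤ m := by
        have := Finset.mem_range.1 hk
        exact_mod_cast this
      rw [min_eq_left (by linarith), max_eq_right zero_le_one, one_mul]
    · rw [min_eq_right (by linarith), max_eq_right (by linarith)]
  · intro k _ hk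
    have hkm : (m : ℝ) + 1 ≤ k := by
      have : m + 1 ≤ k := by simpa using hk
      exact_mod_cast this
    rw [max_eq_left ((min_le_right _ _).trans (by linarith)), zero_mul]

theorem continuous_interpFun (e : List Bool → ℝ) (n : ℕ) :
    Continuous fun t : unitInterval => interpFun e n t := by
  have h : (fun t : unitInterval => interpFun e n t) = fun t : unitInterval =>
      ∑ k ∈ Finset.range (2 ^ n + 1), max 0 (min 1 (2 ^ n * (t : ℝ) - k)) * step e n k :=
    funext fun t => interpFun_eq_sum e n t.2.1 t.2.2
  rw [h]
  fun_prop

/-- The interpolated walk as an element of `C([0,1])`. -/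
def interp (e : List Bool → ℝ) (n : ℕ) : C(unitInterval, ℝ) :=
  ⟨fun t => interpFun e n t, continuous_interpFun e n⟩

/-- `B_n = 2^{-nH} [S_{[2ⁿ t]} + (2ⁿ t - [2ⁿ t]) ξ_{[2ⁿ t]}]`, for a finite exponent `H`. -/
def cascade (H : ℝ) (e : List Bool → ℝ) (n : ℕ) : C(unitInterval, ℝ) :=
  (2 : ℝ) ^ (-(n * H)) • interp e n

/-- The constant `σ`, for a finite exponent `H ≤ 1/2`. -/
def sigma (H : ℝ) : ℝ :=
  if H < 1 / 2 then √(1 + ((2 : ℝ) ^ (2 - 2 * H) - 2)⁻¹) else 1 / √2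

/-- The normalized process `X_n` for a finite exponent `H ≤ 1/2`: it is
`B_n / (σ 2^{n(1/2 - H)})` if `H < 1/2` and `B_n / (σ √n)` if `H = 1/2`. -/
def normalizedReal (H : ℝ) (e : List Bool → ℝ) (n : ℕ) : C(unitInterval, ℝ) :=
  if H < 1 / 2 then (sigma H * (2 : ℝ) ^ (n * (1 / 2 - H)))⁻¹ • cascade H e n
  else (sigma H * √n)⁻¹ • cascade H e n

/-- The normalized process `X_n` for `H ∈ [-∞, 1/2]`; for `H = -∞` it is
`2^{-n/2} [S_{[2ⁿ t]} + (2ⁿ t - [2ⁿ t]) ξ_{[2ⁿ t]}]`. -/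
def normalized (H : EReal) (e : List Bool → ℝ) (n : ℕ) : C(unitInterval, ℝ) :=
  if H = ⊥ then (√(2 ^ n))⁻¹ • interp e n else normalizedReal H.toReal e n

/-! ### Brownian motion on `[0,1]` -/

/-- `W` is the law on `C([0,1])` of a standard Brownian motion restricted to `[0,1]`: under `W`,
the coordinate process starts from `0`, has independent increments, and its increment between
`s ≤ t` is centered Gaussian with variance `t - s`. -/
structure IsWienerMeasure (W : Measure C(unitInterval, ℝ)) : Prop where
  start_zero : ∀ᵐ f ∂W, f 0 = 0
  indep_increments : HasIndepIncrements (fun (t : unitInterval) (f : C(unitInterval, ℝ)) => f t) W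
  gaussian_increments : ∀ s t : unitInterval, s ≤ t →
    HasLaw (fun f : C(unitInterval, ℝ) => f t - f s) (gaussianReal 0 (Real.toNNReal (t - s))) W

end SignedCascade

end

/-!
Below each of the two words of length one, the signs form an independent copy of the whole family,
so `S_{2 ^ (n + 1)}` is the sum of two independent terms, each of which is a sign `ε` times a copy
of `S_{2 ^ n}`. This gives recursions in `n` for the moments and for the characteristic functions
of the walk. With `m` the mean of the signs and `2 * m ^ 2 ≤ 1`, the first one bounds the fourth
moment by nine times the square of the second moment `v n`, and shows that
`v (q + p) / v q → 2 ^ p` as `q → ∞`, while the squared mean is negligible with respect to `v`.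

At level `q + p` the walk is made of `2 ^ p` blocks, each a sign times a copy of the walk of level
`q`. Multiplying by the signs above the blocks acts on a characteristic function by
`z ↦ re z + i m im z`, a contraction which fixes the real numbers. Since the characteristic
function of a block is real up to an error of smaller order, that of a linear combination of the
blocks differs from a product of Gaussian factors by at most the sum of the errors of the single
blocks, and so the dyadic increments are asymptotically independent and Gaussian.

The fourth moments of the dyadic increments give tightness by Kolmogorov's criterion. A limit point
is determined by the law of its dyadic increments, hence all limit points are the Wiener measure.
The closed form of `v n` shows that the normalizing constants are equivalent to `v n ^ (-1 / 2)`.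
-/

noncomputable section

namespace SignedCascade

/-! ### The branching structure of the walk -/

section Subtree

variable {α : Type*}

/-- The restriction of a family indexed by the words to the subtree of the words starting
with `u`, reindexed by the remaining digits. -/
def subtree (e : List Bool → α) (u v : List Bool) : α := e (u ++ v)

variable (e : List Bool → ℝ)

theorem signProd_append (u v : List Bool) :
    signProd e (u ++ v) = signProd e u * signProd (subtree e u) v := by
  unfold signProd subtree
  rw [List.length_append, Finset.prod_range_add]
  congr 1 <;> refine Finset.prod_congr rfl fun k hk => ?_
  · rw [List.take_append_of_le_length (Finset.mem_range.1 hk)]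
  · rw [add_assoc, List.take_length_add_append]

theorem signProd_singleton (b : Bool) : signProd e [b] = e [b] := by
  simp [signProd]

theorem dyadicWord_two_pow_mul_add {q k : ℕ} (hk : k < 2 ^ q) (p j : ℕ) :
    dyadicWord (q + p) (2 ^ q * j + k) = dyadicWord p j ++ dyadicWord q k := by
  induction p with
  | zero =>
    suffices ∀ n ≤ q, dyadicWord n (2 ^ q * j + k) = dyadicWord n k from this q le_rfl
    intro n hn
    induction n with
    | zero => rfl
    | succ n ih =>
      simp only [dyadicWord, ih (Nat.le_of_succ_le hn), Nat.testBit_two_pow_mul_add j hk,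
        if_pos (Nat.lt_of_succ_le hn)]
  | succ p ih =>
    rw [← add_assoc, dyadicWord, dyadicWord, ih, Nat.testBit_two_pow_mul_add j hk]
    simp

theorem step_two_pow_mul_add {q k : ℕ} (hk : k < 2 ^ q) (p j : ℕ) :
    step e (q + p) (2 ^ q * j + k) =
      signProd e (dyadicWord p j) * step (subtree e (dyadicWord p j)) q k := by
  rw [step, dyadicWord_two_pow_mul_add hk, signProd_append, step]

theorem walk_two_pow_mul_sub (q p j : ℕ) :
    walk e (q + p) (2 ^ q * (j + 1)) - walk e (q + p) (2 ^ q * j) =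
      signProd e (dyadicWord p j) * walk (subtree e (dyadicWord p j)) q (2 ^ q) := by
  rw [walk, walk, mul_add_one, Finset.sum_range_add, add_sub_cancel_left, walk, Finset.mul_sum]
  exact Finset.sum_congr rfl fun k hk => step_two_pow_mul_add e (Finset.mem_range.1 hk) p j

end Subtree

/-- The sum `∑_{k < 2 ^ n} lam k * ξ_k` of the steps of level `n` with weights `lam`. -/
def stepSum (e : List Bool → ℝ) (n : ℕ) (lam : ℕ → ℝ) : ℝ :=
  ∑ k ∈ Finset.range (2 ^ n), lam k * step e n k

section StepSum

variable (e : List Bool → ℝ)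

theorem stepSum_zero (lam : ℕ → ℝ) : stepSum e 0 lam = lam 0 := by
  simp [stepSum, step, dyadicWord, signProd]

theorem stepSum_succ (n : ℕ) (lam : ℕ → ℝ) :
    stepSum e (n + 1) lam = e [false] * stepSum (subtree e [false]) n lam +
      e [true] * stepSum (subtree e [true]) n (fun k => lam (2 ^ n + k)) := by
  unfold stepSum
  rw [pow_succ, mul_two, Finset.sum_range_add, Finset.mul_sum, Finset.mul_sum]
  congr 1 <;> refine Finset.sum_congr rfl fun k hk => ?_
  · have h := step_two_pow_mul_add e (Finset.mem_range.1 hk) 1 0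
    rw [mul_zero, zero_add, show dyadicWord 1 0 = [false] from rfl, signProd_singleton] at h
    rw [h]; ring
  · have h := step_two_pow_mul_add e (Finset.mem_range.1 hk) 1 1
    rw [mul_one, show dyadicWord 1 1 = [true] from rfl, signProd_singleton] at h
    rw [h]; ring

theorem walk_eq_stepSum (n : ℕ) : walk e n (2 ^ n) = stepSum e n fun _ => 1 := by
  simp only [walk, stepSum, one_mul]

theorem abs_stepSum_le (he : ∀ w, |e w| = 1) (n : ℕ) (lam : ℕ → ℝ) :
    |stepSum e n lam| ≤ ∑ k ∈ Finset.range (2 ^ n), |lam k| := by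
  refine (Finset.abs_sum_le_sum_abs _ _).trans_eq (Finset.sum_congr rfl fun k _ => ?_)
  rw [abs_mul, step, signProd, Finset.abs_prod, Finset.prod_eq_one fun i _ => he _, mul_one]

theorem measurable_stepSum {Ω : Type*} [MeasurableSpace Ω] {ε : List Bool → Ω → ℝ}
    (hε : ∀ w, w ≠ [] → Measurable (ε w)) (n : ℕ) (lam : ℕ → ℝ) :
    Measurable fun ω => stepSum (fun w => ε w ω) n lam := by
  induction n generalizing ε lam with
  | zero => simp only [stepSum_zero]; fun_prop
  | succ n ih =>
    have hsub (b : Bool) (lam : ℕ → ℝ) :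
        Measurable fun ω => stepSum (fun w => subtree ε [b] w ω) n lam :=
      ih (fun w _ => hε _ (by simp)) lam
    have hroot (b : Bool) : Measurable (ε [b]) := hε _ (by simp)
    simp only [stepSum_succ]
    exact ((hroot _).mul (hsub _ _)).add ((hroot _).mul (hsub _ _))

end StepSum

/-! ### Families of independent signs -/

/-- Independent random variables, indexed by the words, with values in `{1, -1}` and common
mean `m`. -/
structure IsSignFamily {Ω : Type*} [MeasurableSpace Ω] (P : Measure Ω) (m : ℝ)
    (ε : List Bool → Ω → ℝ) : Prop where
  measurable : ∀ w, Measurable (ε w)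
  indep : iIndepFun ε P
  eq_one_or : ∀ w ω, ε w ω = 1 ∨ ε w ω = -1
  mean : ∀ w, ∫ ω, ε w ω ∂P = m

/-- The `σ`-algebra generated by the variables indexed by `S`; it expresses that a functional of
the family only depends on these variables. -/
abbrev sigmaOn {ι Ω : Type*} (X : ι → Ω → ℝ) (S : Set ι) : MeasurableSpace Ω :=
  ⨆ i ∈ S, MeasurableSpace.comap (X i) inferInstance

theorem measurable_sigmaOn {ι Ω : Type*} (X : ι → Ω → ℝ) {S : Set ι} {i : ι} (hi : i ∈ S) :
    Measurable[sigmaOn X S] (X i) :=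
  (comap_measurable (X i)).mono
    (le_iSup₂_of_le (f := fun i (_ : i ∈ S) => MeasurableSpace.comap (X i) inferInstance) i hi
      le_rfl) le_rfl

theorem indepFun_of_disjoint_sigmaOn {ι Ω : Type*} [MeasurableSpace Ω] {P : Measure Ω}
    {X : ι → Ω → ℝ} (hX : ∀ i, Measurable (X i)) (hind : iIndepFun X P) {S T : Set ι}
    (hST : Disjoint S T) {Y Z : Ω → ℝ} (hY : Measurable[sigmaOn X S] Y)
    (hZ : Measurable[sigmaOn X T] Z) : IndepFun Y Z P := by
  rw [IndepFun_iff_Indep]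
  exact indep_of_indep_of_le_left (indep_of_indep_of_le_right
    (indep_iSup_of_disjoint (fun i => (hX i).comap_le) hind hST) hZ.comap_le) hY.comap_le

namespace IsSignFamily

variable {Ω : Type*} [MeasurableSpace Ω] {P : Measure Ω} {m : ℝ} {ε : List Bool → Ω → ℝ}

theorem subtree (h : IsSignFamily P m ε) (u : List Bool) : IsSignFamily P m (subtree ε u) where
  measurable _ := h.measurable _
  indep := h.indep.precomp (g := fun v => u ++ v) fun _ _ => List.append_cancel_left
  eq_one_or _ := h.eq_one_or _
  mean _ := h.mean _

theorem measurable_stepSum (h : IsSignFamily P m ε) (n : ℕ) (lam : ℕ → ℝ) :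
    Measurable fun ω => stepSum (fun w => ε w ω) n lam :=
  SignedCascade.measurable_stepSum (fun w _ => h.measurable w) n lam

theorem abs_eq_one (h : IsSignFamily P m ε) (w : List Bool) (ω : Ω) : |ε w ω| = 1 := by
  rcases h.eq_one_or w ω with h | h <;> simp [h]

theorem abs_signProd (h : IsSignFamily P m ε) (w : List Bool) (ω : Ω) :
    |signProd (fun v => ε v ω) w| = 1 := by
  rw [signProd, Finset.abs_prod, Finset.prod_eq_one fun i _ => h.abs_eq_one _ ω]

theorem integrable_stepSum_pow [IsFiniteMeasure P] (h : IsSignFamily P m ε) (n : ℕ)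
    (lam : ℕ → ℝ) (k : ℕ) : Integrable (fun ω => stepSum (fun w => ε w ω) n lam ^ k) P := by
  refine Integrable.of_bound ((h.measurable_stepSum n lam).pow_const k).aestronglyMeasurable
    ((∑ k ∈ Finset.range (2 ^ n), |lam k|) ^ k) (Eventually.of_forall fun ω => ?_)
  rw [norm_pow, Real.norm_eq_abs]
  exact pow_le_pow_left₀ (abs_nonneg _) (abs_stepSum_le _ (h.abs_eq_one · ω) n lam) k

theorem indepFun_sign_stepSum (h : IsSignFamily P m ε) (b : Bool) (n : ℕ) (lam : ℕ → ℝ) :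
    IndepFun (ε [b]) (fun ω => stepSum (fun w => SignedCascade.subtree ε [b] w ω) n lam) P := by
  refine indepFun_of_disjoint_sigmaOn h.measurable h.indep (S := {[b]}) (T := {[b]}ᶜ)
    disjoint_compl_right (measurable_sigmaOn ε rfl) ?_
  refine @SignedCascade.measurable_stepSum Ω (sigmaOn ε _) _
    (fun w hw => measurable_sigmaOn ε ?_) n lam
  simpa using hw

theorem indepFun_stepSum (h : IsSignFamily P m ε) (n : ℕ) (lam lam' : ℕ → ℝ) :
    IndepFun (fun ω => ε [false] ω * stepSum (fun w => SignedCascade.subtree ε [false] w ω) n lam)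
      (fun ω => ε [true] ω * stepSum (fun w => SignedCascade.subtree ε [true] w ω) n lam') P := by
  have hhalf (b : Bool) (lam : ℕ → ℝ) : Measurable[sigmaOn ε {w | w.head? = some b}]
      fun ω => ε [b] ω * stepSum (fun w => SignedCascade.subtree ε [b] w ω) n lam := by
    have hsub := @SignedCascade.measurable_stepSum Ω (sigmaOn ε {w | w.head? = some b})
      (SignedCascade.subtree ε [b]) (fun w _ => measurable_sigmaOn ε (i := [b] ++ w) rfl) n lam
    exact Measurable.mul (measurable_sigmaOn ε (i := [b]) rfl) hsub
  refine indepFun_of_disjoint_sigmaOn h.measurable h.indep (Set.disjoint_left.2 ?_)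
    (hhalf false lam) (hhalf true lam')
  simp +contextual

end IsSignFamily

/-! ### Moments of the walk -/

section IndependentMoments

variable {Ω : Type*} [MeasurableSpace Ω] {P : Measure Ω} {X Y : Ω → ℝ}

theorem integral_add_pow_of_indepFun (hXY : IndepFun X Y P)
    (hX : ∀ k, Integrable (fun ω => X ω ^ k) P) (hY : ∀ k, Integrable (fun ω => Y ω ^ k) P)
    (n : ℕ) :
    ∫ ω, (X ω + Y ω) ^ n ∂P =
      ∑ i ∈ Finset.range (n + 1), n.choose i * ((∫ ω, X ω ^ i ∂P) * ∫ ω, Y ω ^ (n - i) ∂P) := by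
  have hpow (i j : ℕ) : IndepFun (fun ω => X ω ^ i) (fun ω => Y ω ^ j) P :=
    hXY.comp (measurable_id.pow_const i) (measurable_id.pow_const j)
  have hint (i j : ℕ) : Integrable (fun ω => X ω ^ i * Y ω ^ j) P :=
    (hpow i j).integrable_mul (hX i) (hY j)
  simp_rw [add_pow]
  rw [integral_finsetSum _ fun i _ => (hint i _).mul_const _]
  refine Finset.sum_congr rfl fun i _ => ?_
  rw [integral_mul_const, (hpow i _).integral_fun_mul_eq_mul_integral
    (hX i).aestronglyMeasurable (hY _).aestronglyMeasurable, mul_comm]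

theorem sq_integral_mul_le (hX : Integrable (fun ω => X ω ^ 2) P)
    (hY : Integrable (fun ω => Y ω ^ 2) P) (hXY : Integrable (fun ω => X ω * Y ω) P) :
    (∫ ω, X ω * Y ω ∂P) ^ 2 ≤ (∫ ω, X ω ^ 2 ∂P) * ∫ ω, Y ω ^ 2 ∂P := by
  have hquad (t : ℝ) : 0 ≤ (∫ ω, X ω ^ 2 ∂P) * (t * t) + (2 * ∫ ω, X ω * Y ω ∂P) * t +
      ∫ ω, Y ω ^ 2 ∂P := by
    calc 0 ≤ ∫ ω, (X ω * t + Y ω) ^ 2 ∂P := integral_nonneg fun ω => sq_nonneg _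
      _ = ∫ ω, (X ω ^ 2 * (t * t) + X ω * Y ω * (2 * t) + Y ω ^ 2) ∂P := by
        congr with ω; ring
      _ = _ := by
        rw [integral_add ((hX.mul_const _).fun_add (hXY.mul_const _)) hY,
          integral_add (hX.mul_const _) (hXY.mul_const _), integral_mul_const, integral_mul_const]
        ring
  have h := discrim_le_zero hquad
  rw [discrim] at h
  linarith

end IndependentMoments

/-- The moment of order `k` of a sign with mean `m`. -/
def signMoment (m : ℝ) (k : ℕ) : ℝ := if Even k then 1 else m

/-- The moment of order `k` of `S_{2 ^ n}`, for signs with mean `m`: the two halves of the walk are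
independent and each of them is a sign times an independent copy of the walk of the previous
level. -/
def walkMoment (m : ℝ) : ℕ → ℕ → ℝ
  | 0, _ => 1
  | n + 1, k => ∑ i ∈ Finset.range (k + 1), k.choose i *
      (signMoment m i * walkMoment m n i * (signMoment m (k - i) * walkMoment m n (k - i)))

section WalkMoment

variable (m : ℝ) (n : ℕ)

theorem walkMoment_order_zero : walkMoment m n 0 = 1 := by
  induction n with
  | zero => rfl
  | succ n ih => simp [walkMoment, signMoment, ih]

theorem walkMoment_one : walkMoment m n 1 = (2 * m) ^ n := by
  induction n with
  | zero => rfl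
  | succ n ih =>
    simp only [walkMoment, Finset.sum_range_succ, Finset.range_one, Finset.sum_singleton,
      signMoment, Even.zero, Nat.not_even_one, ↓reduceIte, Nat.choose, Nat.cast_one, tsub_zero,
      tsub_self, add_zero, walkMoment_order_zero, ih, pow_succ]
    ring

theorem walkMoment_two_succ : walkMoment m (n + 1) 2 =
    2 * walkMoment m n 2 + 2 * m ^ 2 * walkMoment m n 1 ^ 2 := by
  simp only [walkMoment, Finset.sum_range_succ, Finset.range_one, Finset.sum_singleton, signMoment,
    Even.zero, Nat.not_even_one, even_two, ↓reduceIte, Nat.choose, Nat.cast_one, Nat.cast_ofNat,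
    Nat.reduceAdd, Nat.reduceSub, tsub_zero, tsub_self, add_zero, walkMoment_order_zero]
  ring

theorem walkMoment_four_succ : walkMoment m (n + 1) 4 =
    2 * walkMoment m n 4 + 8 * m ^ 2 * (walkMoment m n 1 * walkMoment m n 3) +
      6 * walkMoment m n 2 ^ 2 := by
  have h3 : ¬ Even 3 := by decide
  have h4 : Even 4 := by decide
  simp only [walkMoment, Finset.sum_range_succ, Finset.range_one, Finset.sum_singleton, signMoment,
    Even.zero, Nat.not_even_one, even_two, h3, h4, ↓reduceIte, Nat.choose, Nat.cast_one,
    Nat.cast_ofNat, Nat.reduceAdd, Nat.reduceSub, tsub_zero, tsub_self, add_zero,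
    walkMoment_order_zero]
  ring

theorem two_pow_mul_walkMoment_two_le (p : ℕ) :
    2 ^ p * walkMoment m n 2 ≤ walkMoment m (n + p) 2 := by
  induction p with
  | zero => simp
  | succ p ih =>
    rw [← add_assoc, walkMoment_two_succ, pow_succ]
    nlinarith [sq_nonneg (m * walkMoment m (n + p) 1)]

theorem two_pow_le_walkMoment_two : 2 ^ n ≤ walkMoment m n 2 := by
  simpa [walkMoment] using two_pow_mul_walkMoment_two_le m 0 n

theorem walkMoment_two_pos : 0 < walkMoment m n 2 :=
  (pow_pos two_pos n).trans_le (two_pow_le_walkMoment_two m n)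

end WalkMoment

namespace IsSignFamily

variable {Ω : Type*} [MeasurableSpace Ω] {P : Measure Ω} {m : ℝ} {ε : List Bool → Ω → ℝ}

theorem integral_sign_pow [IsProbabilityMeasure P] (h : IsSignFamily P m ε) (w : List Bool)
    (k : ℕ) : ∫ ω, ε w ω ^ k ∂P = signMoment m k := by
  rcases Nat.even_or_odd k with hk | hk
  · have hone (ω : Ω) : ε w ω ^ k = 1 := by
      rcases h.eq_one_or w ω with h | h <;> simp [h, hk.neg_one_pow]
    simp [hone, signMoment, hk]
  · have hself (ω : Ω) : ε w ω ^ k = ε w ω := by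
      rcases h.eq_one_or w ω with h | h <;> simp [h, hk.neg_one_pow]
    simp [hself, signMoment, Nat.not_even_iff_odd.2 hk, h.mean]

theorem integral_sign_mul_stepSum_pow [IsProbabilityMeasure P] (h : IsSignFamily P m ε) (b : Bool)
    (n : ℕ) (lam : ℕ → ℝ) (k : ℕ) :
    ∫ ω, (ε [b] ω * stepSum (fun w => SignedCascade.subtree ε [b] w ω) n lam) ^ k ∂P =
      signMoment m k * ∫ ω, stepSum (fun w => SignedCascade.subtree ε [b] w ω) n lam ^ k ∂P := by
  simp_rw [mul_pow]
  rw [← h.integral_sign_pow [b] k]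
  exact ((h.indepFun_sign_stepSum b n lam).comp (measurable_id.pow_const k)
    (measurable_id.pow_const k)).integral_fun_mul_eq_mul_integral
    ((h.measurable _).pow_const k).aestronglyMeasurable
    (((h.subtree [b]).measurable_stepSum n lam).pow_const k).aestronglyMeasurable

variable [IsProbabilityMeasure P]

theorem integral_walk_pow (h : IsSignFamily P m ε) (n k : ℕ) :
    ∫ ω, walk (fun w => ε w ω) n (2 ^ n) ^ k ∂P = walkMoment m n k := by
  simp_rw [walk_eq_stepSum]
  induction n generalizing ε k with
  | zero => simp [stepSum_zero, walkMoment]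
  | succ n ih =>
    have hhalf (b : Bool) (k : ℕ) : ∫ ω, (ε [b] ω *
        stepSum (fun w => SignedCascade.subtree ε [b] w ω) n fun _ => 1) ^ k ∂P =
          signMoment m k * walkMoment m n k := by
      rw [h.integral_sign_mul_stepSum_pow, ih (h.subtree [b])]
    have hint (b : Bool) (k : ℕ) : Integrable (fun ω => (ε [b] ω *
        stepSum (fun w => SignedCascade.subtree ε [b] w ω) n fun _ => 1) ^ k) P := by
      simp_rw [mul_pow]
      refine ((h.subtree [b]).integrable_stepSum_pow n _ k).bdd_mul (c := 1)
        ((h.measurable _).pow_const k).aestronglyMeasurable (Eventually.of_forall fun ω => ?_)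
      simp [h.abs_eq_one]
    rw [walkMoment, ← Finset.sum_congr rfl fun i _ => by rw [← hhalf false, ← hhalf true]]
    simp_rw [stepSum_succ]
    exact integral_add_pow_of_indepFun (h.indepFun_stepSum n _ _) (hint false) (hint true) k

theorem integrable_walk_pow (h : IsSignFamily P m ε) (n k : ℕ) :
    Integrable (fun ω => walk (fun w => ε w ω) n (2 ^ n) ^ k) P := by
  simp_rw [walk_eq_stepSum]
  exact h.integrable_stepSum_pow n _ k

theorem sq_walkMoment_add_le (h : IsSignFamily P m ε) (n k l : ℕ) :
    walkMoment m n (k + l) ^ 2 ≤ walkMoment m n (2 * k) * walkMoment m n (2 * l) := by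
  simp_rw [← h.integral_walk_pow, pow_add, pow_mul']
  exact sq_integral_mul_le (by simpa only [← pow_mul] using h.integrable_walk_pow n _)
    (by simpa only [← pow_mul] using h.integrable_walk_pow n _)
    (by simpa only [← pow_add] using h.integrable_walk_pow n _)

theorem walkMoment_four_le (h : IsSignFamily P m ε) (hm : m ^ 2 ≤ 1 / 2) (n : ℕ) :
    walkMoment m n 4 ≤ 9 * walkMoment m n 2 ^ 2 := by
  induction n with
  | zero => norm_num [walkMoment]
  | succ n ih =>
    have hpos := walkMoment_two_pos m n
    have hmixed : |walkMoment m n 1 * walkMoment m n 3| ≤ 3 * walkMoment m n 2 ^ 2 := by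
      have h1 : walkMoment m n 1 ^ 2 ≤ walkMoment m n 2 := by
        simpa [walkMoment_order_zero] using h.sq_walkMoment_add_le n 1 0
      have h3 : walkMoment m n 3 ^ 2 ≤ walkMoment m n 2 * walkMoment m n 4 :=
        h.sq_walkMoment_add_le n 1 2
      refine abs_le_of_sq_le_sq ?_ (by positivity)
      calc (walkMoment m n 1 * walkMoment m n 3) ^ 2
          ≤ walkMoment m n 2 * (walkMoment m n 2 * (9 * walkMoment m n 2 ^ 2)) := by
            rw [mul_pow]; gcongr; exact h3.trans (by gcongr)
        _ = (3 * walkMoment m n 2 ^ 2) ^ 2 := by ring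
    calc walkMoment m (n + 1) 4
        ≤ 2 * (9 * walkMoment m n 2 ^ 2) + 8 * (1 / 2) * (3 * walkMoment m n 2 ^ 2) +
          6 * walkMoment m n 2 ^ 2 := by
          rw [walkMoment_four_succ]
          gcongr 2 * ?_ + ?_ + _
          calc _ ≤ 8 * m ^ 2 * |walkMoment m n 1 * walkMoment m n 3| := by
                gcongr; exact le_abs_self _
            _ ≤ _ := by gcongr
      _ = 9 * (2 ^ 1 * walkMoment m n 2) ^ 2 := by ring
      _ ≤ 9 * walkMoment m (n + 1) 2 ^ 2 := by
          gcongr; exact two_pow_mul_walkMoment_two_le m n 1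

end IsSignFamily

/-! ### Characteristic functions of weighted sums of the steps -/

/-- The map that sends the characteristic function at `1` of `Y` to that of `s * Y`, when `s` is a
sign with mean `m` which is independent of `Y`. -/
def damp (m : ℝ) (z : ℂ) : ℂ := ⟨z.re, m * z.im⟩

/-- The characteristic function at `1` of `stepSum`, for signs with mean `m`. -/
def treeChar (m : ℝ) : ℕ → (ℕ → ℝ) → ℂ
  | 0, lam => Complex.exp (lam 0 * Complex.I)
  | n + 1, lam => damp m (treeChar m n lam) * damp m (treeChar m n fun k => lam (2 ^ n + k))

section IntegralExp

variable {Ω : Type*} [MeasurableSpace Ω] {P : Measure Ω}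

section Finite

variable [IsFiniteMeasure P]

theorem integrable_exp_mul_I {Y : Ω → ℝ} (hY : AEMeasurable Y P) :
    Integrable (fun ω => Complex.exp (Y ω * Complex.I)) P :=
  Integrable.of_bound (by fun_prop) 1
    (Eventually.of_forall fun _ => (Complex.norm_exp_ofReal_mul_I _).le)

theorem integral_exp_mul_I {Y : Ω → ℝ} (hY : AEMeasurable Y P) :
    ∫ ω, Complex.exp (Y ω * Complex.I) ∂P =
      ⟨∫ ω, Real.cos (Y ω) ∂P, ∫ ω, Real.sin (Y ω) ∂P⟩ := by
  apply Complex.ext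
  · simpa [Complex.exp_ofReal_mul_I_re] using (integral_re (integrable_exp_mul_I hY)).symm
  · simpa [Complex.exp_ofReal_mul_I_im] using (integral_im (integrable_exp_mul_I hY)).symm

theorem integral_exp_sign_mul {m : ℝ} {s Y : Ω → ℝ} (hs : Measurable s) (hY : Measurable Y)
    (hs1 : ∀ ω, s ω = 1 ∨ s ω = -1) (hsm : ∫ ω, s ω ∂P = m) (hind : IndepFun s Y P) :
    ∫ ω, Complex.exp ((s ω * Y ω : ℝ) * Complex.I) ∂P =
      damp m (∫ ω, Complex.exp (Y ω * Complex.I) ∂P) := by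
  have hcos (ω : Ω) : Real.cos (s ω * Y ω) = Real.cos (Y ω) := by
    rcases hs1 ω with h | h <;> simp [h]
  have hsin (ω : Ω) : Real.sin (s ω * Y ω) = s ω * Real.sin (Y ω) := by
    rcases hs1 ω with h | h <;> simp [h]
  rw [integral_exp_mul_I hY.aemeasurable, integral_exp_mul_I
    (Y := fun ω => s ω * Y ω) (hs.mul hY).aemeasurable, damp]
  simp_rw [hcos, hsin]
  have hmul : ∫ ω, s ω * Real.sin (Y ω) ∂P = (∫ ω, s ω ∂P) * ∫ ω, Real.sin (Y ω) ∂P :=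
    (hind.comp measurable_id Real.measurable_sin).integral_fun_mul_eq_mul_integral
      hs.aestronglyMeasurable (Real.measurable_sin.comp hY).aestronglyMeasurable
  rw [hmul, hsm]

end Finite

theorem IsSignFamily.integral_exp_stepSum [IsProbabilityMeasure P] {m : ℝ} {ε : List Bool → Ω → ℝ}
    (h : IsSignFamily P m ε) (n : ℕ) (lam : ℕ → ℝ) :
    ∫ ω, Complex.exp (stepSum (fun w => ε w ω) n lam * Complex.I) ∂P = treeChar m n lam := by
  induction n generalizing ε lam with
  | zero => simp [stepSum_zero, treeChar]
  | succ n ih =>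
    have hhalf (b : Bool) (lam : ℕ → ℝ) := integral_exp_sign_mul (h.measurable [b])
      ((h.subtree [b]).measurable_stepSum n lam) (h.eq_one_or [b]) (h.mean [b])
      (h.indepFun_sign_stepSum b n lam)
    have hmeas (b : Bool) (lam : ℕ → ℝ) :=
      (h.measurable [b]).mul ((h.subtree [b]).measurable_stepSum n lam)
    have hexp : Measurable fun x : ℝ => Complex.exp (x * Complex.I) := by fun_prop
    simp only [stepSum_succ, treeChar]
    rw [← ih (h.subtree [false]), ← ih (h.subtree [true]), ← hhalf, ← hhalf]
    simp_rw [Complex.ofReal_add, add_mul, Complex.exp_add]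
    exact ((h.indepFun_stepSum n lam fun k => lam (2 ^ n + k)).comp hexp
      hexp).integral_fun_mul_eq_mul_integral (hexp.comp (hmeas false _)).aestronglyMeasurable
      (hexp.comp (hmeas true _)).aestronglyMeasurable

end IntegralExp

section Comparison

variable {m : ℝ}

theorem norm_damp_sub_ofReal_le (hm : m ^ 2 ≤ 1) (z : ℂ) (x : ℝ) :
    ‖damp m z - x‖ ≤ ‖z - x‖ := by
  rw [← sq_le_sq₀ (norm_nonneg _) (norm_nonneg _), Complex.sq_norm, Complex.sq_norm,
    Complex.normSq_apply, Complex.normSq_apply, damp]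
  simp only [Complex.sub_re, Complex.sub_im, Complex.ofReal_re, Complex.ofReal_im, sub_zero]
  nlinarith [mul_nonneg (sub_nonneg.2 hm) (sq_nonneg z.im)]

theorem norm_damp_le (hm : m ^ 2 ≤ 1) (z : ℂ) : ‖damp m z‖ ≤ ‖z‖ := by
  simpa using norm_damp_sub_ofReal_le hm z 0

theorem norm_treeChar_le (hm : m ^ 2 ≤ 1) (n : ℕ) (lam : ℕ → ℝ) : ‖treeChar m n lam‖ ≤ 1 := by
  induction n generalizing lam with
  | zero => exact (Complex.norm_exp_ofReal_mul_I _).le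
  | succ n ih =>
    rw [treeChar, norm_mul]
    exact mul_le_one₀ ((norm_damp_le hm _).trans (ih _)) (norm_nonneg _)
      ((norm_damp_le hm _).trans (ih _))

theorem treeChar_congr (n : ℕ) {lam lam' : ℕ → ℝ} (h : ∀ k < 2 ^ n, lam k = lam' k) :
    treeChar m n lam = treeChar m n lam' := by
  induction n generalizing lam lam' with
  | zero => rw [treeChar, treeChar, h 0 Nat.one_pos]
  | succ n ih =>
    rw [treeChar, treeChar, ih fun k hk => h k ?_, ih fun k hk => h (2 ^ n + k) ?_] <;>
      rw [pow_succ] <;> omega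

theorem norm_mul_sub_mul_le {R : Type*} [SeminormedRing R] {z w a b : R} (hw : ‖w‖ ≤ 1)
    (ha : ‖a‖ ≤ 1) : ‖z * w - a * b‖ ≤ ‖z - a‖ + ‖w - b‖ :=
  calc ‖z * w - a * b‖ = ‖(z - a) * w + a * (w - b)‖ := by congr 1; noncomm_ring
    _ ≤ ‖z - a‖ * ‖w‖ + ‖a‖ * ‖w - b‖ := norm_add_le_of_le (norm_mul_le _ _) (norm_mul_le _ _)
    _ ≤ ‖z - a‖ * 1 + 1 * ‖w - b‖ := by gcongr
    _ = ‖z - a‖ + ‖w - b‖ := by rw [mul_one, one_mul]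

-- Reals are fixed by `damp`, so replacing each block by a real number costs nothing at the
-- levels above the blocks.
theorem norm_treeChar_sub_prod_le (hm : m ^ 2 ≤ 1) (q p : ℕ) (lam y : ℕ → ℝ)
    (hy : ∀ j, |y j| ≤ 1) :
    ‖treeChar m (q + p) lam - ((∏ j ∈ Finset.range (2 ^ p), y j : ℝ) : ℂ)‖ ≤
      ∑ j ∈ Finset.range (2 ^ p), ‖treeChar m q (fun k => lam (2 ^ q * j + k)) - y j‖ := by
  induction p generalizing lam y with
  | zero => simp
  | succ p ih =>
    have hprod : |∏ j ∈ Finset.range (2 ^ p), y j| ≤ 1 := by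
      rw [Finset.abs_prod]
      exact Finset.prod_le_one (fun _ _ => abs_nonneg _) fun _ _ => hy _
    rw [← add_assoc, treeChar, pow_succ, mul_two, Finset.prod_range_add, Finset.sum_range_add,
      Complex.ofReal_mul]
    refine (norm_mul_sub_mul_le ((norm_damp_le hm _).trans (norm_treeChar_le hm _ _))
      (by rwa [Complex.norm_real])).trans (add_le_add ?_ ?_)
    · exact (norm_damp_sub_ofReal_le hm _ _).trans (ih lam y hy)
    · refine (norm_damp_sub_ofReal_le hm _ _).trans ((ih _ (fun j => y (2 ^ p + j))
        fun j => hy _).trans_eq ?_)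
      simp only [pow_add, mul_add, add_assoc]

end Comparison

/-! ### The central limit theorem for the walk -/

section Expansion

theorem norm_exp_mul_I_sub_le (x : ℝ) :
    ‖Complex.exp (x * Complex.I) - (1 + x * Complex.I - (x ^ 2 / 2 : ℝ))‖ ≤ 4 * |x| ^ 3 := by
  rcases le_or_gt |x| 1 with h | h
  · have hexp := Complex.exp_bound (x := x * Complex.I) (by simpa using h) (n := 3) (by norm_num)
    have hsum : ∑ k ∈ Finset.range 3, ((x : ℂ) * Complex.I) ^ k / (k.factorial : ℂ) =
        1 + x * Complex.I - (x ^ 2 / 2 : ℝ) := by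
      simp only [Finset.sum_range_succ, Finset.range_one, Finset.sum_singleton, mul_pow,
        Complex.I_sq, Nat.factorial_zero, Nat.factorial_one, Nat.factorial_two, Nat.cast_one,
        Nat.cast_ofNat]
      push_cast
      ring
    rw [hsum, norm_mul, Complex.norm_real, Complex.norm_I, mul_one, Real.norm_eq_abs] at hexp
    refine hexp.trans ?_
    rw [mul_comm]
    gcongr
    norm_num [Nat.factorial]
  · calc ‖Complex.exp (x * Complex.I) - (1 + x * Complex.I - (x ^ 2 / 2 : ℝ))‖
        ≤ 1 + (1 + |x| + |x| ^ 2 / 2) := by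
          refine (norm_sub_le _ _).trans (add_le_add (Complex.norm_exp_ofReal_mul_I _).le
            ((norm_sub_le _ _).trans (add_le_add ((norm_add_le _ _).trans ?_) ?_))) <;> simp
      _ ≤ 4 * |x| ^ 3 := by nlinarith [mul_pos (sub_pos.2 h) (sub_pos.2 h), pow_pos (sub_pos.2 h) 3]

variable {Ω : Type*} [MeasurableSpace Ω] {P : Measure Ω} {Y : Ω → ℝ}

theorem sq_integral_abs_pow_three_le (hY2 : Integrable (fun ω => Y ω ^ 2) P)
    (hY3 : Integrable (fun ω => |Y ω| ^ 3) P) (hY4 : Integrable (fun ω => Y ω ^ 4) P) :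
    (∫ ω, |Y ω| ^ 3 ∂P) ^ 2 ≤ (∫ ω, Y ω ^ 2 ∂P) * ∫ ω, Y ω ^ 4 ∂P := by
  have h := sq_integral_mul_le (P := P) (X := fun ω => |Y ω|) (Y := fun ω => |Y ω| ^ 2)
    (by simpa only [sq_abs] using hY2) (by simpa only [sq_abs, ← pow_mul] using hY4)
    (by simpa only [← pow_succ'] using hY3)
  simp only [← pow_succ', ← pow_mul] at h
  simpa only [sq_abs, Nat.reduceAdd, Nat.reduceMul, Even.pow_abs (show Even 4 by decide)] using h

theorem norm_integral_exp_mul_I_sub_le [IsProbabilityMeasure P] (hY1 : Integrable Y P)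
    (hY2 : Integrable (fun ω => Y ω ^ 2) P) (hY3 : Integrable (fun ω => |Y ω| ^ 3) P) :
    ‖∫ ω, Complex.exp (Y ω * Complex.I) ∂P -
      (1 + (∫ ω, Y ω ∂P : ℝ) * Complex.I - ((∫ ω, Y ω ^ 2 ∂P) / 2 : ℝ))‖ ≤
        4 * ∫ ω, |Y ω| ^ 3 ∂P := by
  have hlin : Integrable (fun ω => (Y ω : ℂ) * Complex.I) P := hY1.ofReal.mul_const _
  have hquad : Integrable (fun ω => ((Y ω ^ 2 / 2 : ℝ) : ℂ)) P := (hY2.div_const 2).ofReal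
  have hpoly : (1 + (∫ ω, Y ω ∂P : ℝ) * Complex.I - ((∫ ω, Y ω ^ 2 ∂P) / 2 : ℝ) : ℂ) =
      ∫ ω, (1 + Y ω * Complex.I - (Y ω ^ 2 / 2 : ℝ)) ∂P := by
    rw [integral_sub ((integrable_const _).fun_add hlin) hquad,
      integral_add (integrable_const _) hlin, integral_mul_const, integral_complex_ofReal,
      integral_complex_ofReal, integral_div]
    simp
  have hpolyint : Integrable (fun ω => (1 + Y ω * Complex.I - (Y ω ^ 2 / 2 : ℝ) : ℂ)) P :=
    ((integrable_const _).fun_add hlin).sub hquad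
  rw [hpoly, ← integral_sub (integrable_exp_mul_I hY1.aemeasurable) hpolyint,
    ← integral_const_mul]
  exact norm_integral_le_of_norm_le (hY3.const_mul 4)
    (Eventually.of_forall fun ω => norm_exp_mul_I_sub_le (Y ω))

end Expansion

section CentralLimit

theorem tendsto_zero_of_le_of_tendsto {a : ℕ → ℝ} {g : ℕ → ℕ → ℝ} {L : ℕ → ℝ} (ha : ∀ n, 0 ≤ a n)
    (hag : ∀ p q, a (q + p) ≤ g p q) (hg : ∀ p, Tendsto (g p) atTop (𝓝 (L p)))
    (hL : Tendsto L atTop (𝓝 0)) : Tendsto a atTop (𝓝 0) := by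
  refine tendsto_order.2 ⟨fun b hb => Eventually.of_forall fun n => hb.trans_le (ha n),
    fun b hb => ?_⟩
  obtain ⟨p, hp⟩ := (hL.eventually_lt_const hb).exists
  have hlt : ∀ᶠ q in atTop, a (q + p) < b :=
    ((hg p).eventually_lt_const hp).mono fun q hq => (hag p q).trans_lt hq
  filter_upwards [(tendsto_sub_atTop_nat p).eventually hlt, eventually_ge_atTop p] with n hn hpn
  rwa [Nat.sub_add_cancel hpn] at hn

variable {m : ℝ}

theorem mul_sq_walkMoment_one_le (hm : m ^ 2 ≤ 1 / 2) (n : ℕ) :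
    n * walkMoment m n 1 ^ 2 ≤ 2 * walkMoment m n 2 := by
  induction n with
  | zero => simp [walkMoment]
  | succ n ih =>
    have hn : 0 ≤ (n : ℝ) * walkMoment m n 1 ^ 2 := by positivity
    have hone : walkMoment m (n + 1) 1 = 2 * m * walkMoment m n 1 := by
      simp only [walkMoment_one, pow_succ']
    rw [walkMoment_two_succ, hone]
    push_cast
    nlinarith

theorem tendsto_sq_walkMoment_one_div (hm : m ^ 2 ≤ 1 / 2) :
    Tendsto (fun n => walkMoment m n 1 ^ 2 / walkMoment m n 2) atTop (𝓝 0) := by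
  refine squeeze_zero' (g := fun n : ℕ => 2 / (n : ℝ))
    (Eventually.of_forall fun n => div_nonneg (sq_nonneg _) (walkMoment_two_pos m n).le) ?_
    (tendsto_const_div_atTop_nhds_zero_nat 2)
  filter_upwards [eventually_gt_atTop 0] with n hn
  rw [div_le_div_iff₀ (walkMoment_two_pos m n) (by exact_mod_cast hn), mul_comm]
  exact mul_sq_walkMoment_one_le hm n

theorem tendsto_walkMoment_two_div (hm : m ^ 2 ≤ 1 / 2) (p : ℕ) :
    Tendsto (fun q => walkMoment m (q + p) 2 / walkMoment m q 2) atTop (𝓝 (2 ^ p)) := by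
  induction p with
  | zero => simp [div_self (walkMoment_two_pos m _).ne']
  | succ p ih =>
    have hone : Tendsto (fun q => walkMoment m (q + 1) 2 / walkMoment m q 2) atTop (𝓝 2) := by
      have h := ((tendsto_sq_walkMoment_one_div hm).const_mul (2 * m ^ 2)).const_add 2
      rw [mul_zero, add_zero] at h
      refine h.congr fun q => ?_
      rw [walkMoment_two_succ]
      field_simp [(walkMoment_two_pos m q).ne']
    rw [pow_succ']
    refine ((hone.comp (tendsto_add_atTop_nat p)).mul ih).congr fun q => ?_
    exact div_mul_div_cancel₀ (walkMoment_two_pos m (q + p)).ne'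

theorem tendsto_sq_mul_walkMoment_two (hm : m ^ 2 ≤ 1 / 2) {c : ℕ → ℝ} {τ : ℝ}
    (hc : Tendsto (fun n => c n ^ 2 * walkMoment m n 2) atTop (𝓝 τ)) (p : ℕ) :
    Tendsto (fun q => c (q + p) ^ 2 * walkMoment m q 2) atTop (𝓝 (τ / 2 ^ p)) := by
  refine ((hc.comp (tendsto_add_atTop_nat p)).div (tendsto_walkMoment_two_div hm p)
    (by positivity)).congr fun q => ?_
  have := (walkMoment_two_pos m (q + p)).ne'
  simp only [Function.comp_apply, Pi.div_apply]
  field_simp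

theorem tendsto_two_pow_mul_exp_error {τ : ℝ} :
    Tendsto (fun p : ℕ => 2 ^ p * |1 - τ / 2 ^ p / 2 - Real.exp (-(τ / 2 ^ p / 2))|) atTop
      (𝓝 0) := by
  have hη : Tendsto (fun p : ℕ => τ / 2 ^ p) atTop (𝓝 0) :=
    tendsto_const_nhds.div_atTop (tendsto_pow_atTop_atTop_of_one_lt one_lt_two)
  have hsq : Tendsto (fun p : ℕ => τ / 4 * (τ / 2 ^ p)) atTop (𝓝 0) := by
    simpa using hη.const_mul (τ / 4)
  have hsmall : ∀ᶠ p : ℕ in atTop, |-(τ / 2 ^ p / 2)| < 1 :=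
    ((hη.div_const 2).neg.abs).eventually_lt_const (by simp)
  refine squeeze_zero' (Eventually.of_forall fun p => by positivity) ?_ hsq
  filter_upwards [hsmall] with p hp
  calc 2 ^ p * |1 - τ / 2 ^ p / 2 - Real.exp (-(τ / 2 ^ p / 2))|
      = 2 ^ p * |Real.exp (-(τ / 2 ^ p / 2)) - 1 - -(τ / 2 ^ p / 2)| := by
        rw [abs_sub_comm]; congr 2; ring
    _ ≤ 2 ^ p * (-(τ / 2 ^ p / 2)) ^ 2 := by
        gcongr; exact Real.abs_exp_sub_one_sub_id_le hp.le
    _ = τ / 4 * (τ / 2 ^ p) := by field_simp; norm_num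

variable {Ω : Type*} [MeasurableSpace Ω] {P : Measure Ω} [IsProbabilityMeasure P]
  {ε : List Bool → Ω → ℝ}

namespace IsSignFamily

theorem norm_treeChar_const_sub_le (h : IsSignFamily P m ε) (hm : m ^ 2 ≤ 1 / 2) (n : ℕ)
    (u : ℝ) :
    ‖treeChar m n (fun _ => u) - (1 + (u * walkMoment m n 1 : ℝ) * Complex.I -
      (u ^ 2 * walkMoment m n 2 / 2 : ℝ))‖ ≤
        12 * (u ^ 2 * walkMoment m n 2 * √(u ^ 2 * walkMoment m n 2)) := by
  set S : Ω → ℝ := fun ω => walk (fun w => ε w ω) n (2 ^ n) with hS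
  set x := u ^ 2 * walkMoment m n 2 with hx
  have hx0 : 0 ≤ x := mul_nonneg (sq_nonneg u) (walkMoment_two_pos m n).le
  have hchar : treeChar m n (fun _ => u) = ∫ ω, Complex.exp ((u * S ω : ℝ) * Complex.I) ∂P := by
    rw [← h.integral_exp_stepSum]
    congr 1 with ω
    simp only [hS, stepSum, walk, Finset.mul_sum]
  have hint (k : ℕ) : Integrable (fun ω => (u * S ω) ^ k) P := by
    simpa only [mul_pow] using (h.integrable_walk_pow n k).const_mul (u ^ k)
  have hmoment (k : ℕ) : ∫ ω, (u * S ω) ^ k ∂P = u ^ k * walkMoment m n k := by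
    simp_rw [mul_pow, integral_const_mul, hS, h.integral_walk_pow]
  have hint1 : Integrable (fun ω => u * S ω) P := by simpa only [pow_one] using hint 1
  have hint3 : Integrable (fun ω => |u * S ω| ^ 3) P := by simpa only [abs_pow] using (hint 3).abs
  have hthird : ∫ ω, |u * S ω| ^ 3 ∂P ≤ 3 * (x * √x) := by
    refine abs_le_of_sq_le_sq' ?_ (by positivity) |>.2
    calc (∫ ω, |u * S ω| ^ 3 ∂P) ^ 2 ≤ x * (u ^ 4 * walkMoment m n 4) := by
          rw [hx, ← hmoment, ← hmoment]
          exact sq_integral_abs_pow_three_le (hint 2) hint3 (hint 4)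
      _ ≤ x * (u ^ 4 * (9 * walkMoment m n 2 ^ 2)) := by gcongr; exact h.walkMoment_four_le hm n
      _ = 9 * x ^ 2 * x := by rw [hx]; ring
      _ = (3 * (x * √x)) ^ 2 := by rw [mul_pow 3, mul_pow x, Real.sq_sqrt hx0]; ring
  have hexp := norm_integral_exp_mul_I_sub_le hint1 (hint 2) hint3
  have hmean : ∫ ω, u * S ω ∂P = u * walkMoment m n 1 := by simpa only [pow_one] using hmoment 1
  rw [← hchar, hmean, hmoment, ← hx] at hexp
  linarith

theorem norm_treeChar_const_sub_exp_le (h : IsSignFamily P m ε) (hm : m ^ 2 ≤ 1 / 2) (q p : ℕ)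
    (u : ℝ) {τ : ℝ} (hτ : 0 ≤ τ) :
    ‖treeChar m (q + p) (fun _ => u) - (Real.exp (-(τ / 2)) : ℝ)‖ ≤
      2 ^ p * (12 * (u ^ 2 * walkMoment m q 2 * √(u ^ 2 * walkMoment m q 2)) +
        |u * walkMoment m q 1| +
        |1 - u ^ 2 * walkMoment m q 2 / 2 - Real.exp (-(τ / 2 ^ p / 2))|) := by
  set y := Real.exp (-(τ / 2 ^ p / 2)) with hy
  have hy1 : |y| ≤ 1 := by
    rw [abs_of_pos (Real.exp_pos _), Real.exp_le_one_iff, neg_nonpos]; positivity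
  have hpow : Real.exp (-(τ / 2)) = y ^ 2 ^ p := by
    rw [hy, ← Real.exp_nat_mul]; congr 1; push_cast; field_simp
  have hblock := norm_treeChar_sub_prod_le (hm.trans (by norm_num)) q p (fun _ => u) (fun _ => y)
    fun _ => hy1
  rw [Finset.prod_const, Finset.sum_const, Finset.card_range, nsmul_eq_mul] at hblock
  push_cast at hblock
  rw [hpow, Complex.ofReal_pow]
  refine hblock.trans (mul_le_mul_of_nonneg_left ?_ (by positivity))
  calc ‖treeChar m q (fun _ => u) - (y : ℂ)‖
      = ‖(treeChar m q (fun _ => u) - (1 + (u * walkMoment m q 1 : ℝ) * Complex.I -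
          (u ^ 2 * walkMoment m q 2 / 2 : ℝ))) + (u * walkMoment m q 1 : ℝ) * Complex.I +
          ((1 - u ^ 2 * walkMoment m q 2 / 2 - y : ℝ) : ℂ)‖ := by
        congr 1; push_cast; ring
    _ ≤ _ := norm_add₃_le
    _ ≤ _ := by
        gcongr
        · exact h.norm_treeChar_const_sub_le hm q u
        · rw [norm_mul, Complex.norm_I, mul_one, Complex.norm_real, Real.norm_eq_abs]
        · rw [Complex.norm_real, Real.norm_eq_abs]

theorem tendsto_treeChar_const (h : IsSignFamily P m ε) (hm : m ^ 2 ≤ 1 / 2)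
    {c : ℕ → ℝ} {τ : ℝ} (hc : Tendsto (fun n => c n ^ 2 * walkMoment m n 2) atTop (𝓝 τ)) :
    Tendsto (fun n => treeChar m n fun _ => c n) atTop (𝓝 (Real.exp (-(τ / 2)) : ℝ)) := by
  have hτ : 0 ≤ τ := ge_of_tendsto' hc fun n =>
    mul_nonneg (sq_nonneg _) (walkMoment_two_pos m n).le
  have hvar := tendsto_sq_mul_walkMoment_two hm hc
  have hmean (p : ℕ) : Tendsto (fun q => |c (q + p) * walkMoment m q 1|) atTop (𝓝 0) := by
    have hsq := ((hvar p).mul (tendsto_sq_walkMoment_one_div hm)).sqrt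
    rw [mul_zero, Real.sqrt_zero] at hsq
    refine hsq.congr fun q => ?_
    have := (walkMoment_two_pos m q).ne'
    rw [← Real.sqrt_sq_eq_abs]
    congr 1
    field_simp
  have hlim (p : ℕ) := (((((hvar p).mul (hvar p).sqrt).const_mul 12).add (hmean p)).add
    (((hvar p).div_const 2).const_sub 1 |>.sub_const (Real.exp (-(τ / 2 ^ p / 2)))).abs).const_mul
      (2 ^ p)
  rw [tendsto_iff_norm_sub_tendsto_zero]
  refine tendsto_zero_of_le_of_tendsto (fun _ => norm_nonneg _)
    (fun p q => h.norm_treeChar_const_sub_exp_le hm q p (c (q + p)) hτ) hlim ?_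
  have hη : Tendsto (fun p : ℕ => √(τ / 2 ^ p)) atTop (𝓝 0) := by
    simpa using (tendsto_const_nhds.div_atTop (tendsto_pow_atTop_atTop_of_one_lt one_lt_two)).sqrt
  have hsum := (hη.const_mul (12 * τ)).add (tendsto_two_pow_mul_exp_error (τ := τ))
  rw [mul_zero, add_zero] at hsum
  refine hsum.congr fun p => ?_
  field_simp
  ring

theorem tendsto_treeChar_block (h : IsSignFamily P m ε) (hm : m ^ 2 ≤ 1 / 2) {c : ℕ → ℝ}
    (hc : Tendsto (fun n => c n ^ 2 * walkMoment m n 2) atTop (𝓝 1)) (p : ℕ) (l : ℕ → ℝ) :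
    Tendsto (fun q => treeChar m (q + p) fun k => c (q + p) * l (k / 2 ^ q)) atTop
      (𝓝 (Real.exp (-((∑ j ∈ Finset.range (2 ^ p), l j ^ 2) / 2 ^ p / 2)) : ℝ)) := by
  have hprod : Real.exp (-((∑ j ∈ Finset.range (2 ^ p), l j ^ 2) / 2 ^ p / 2)) =
      ∏ j ∈ Finset.range (2 ^ p), Real.exp (-(l j ^ 2 / 2 ^ p / 2)) := by
    rw [← Real.exp_sum, Finset.sum_neg_distrib, Finset.sum_div, Finset.sum_div]
  have hconst (q j : ℕ) : (treeChar m q fun k => c (q + p) * l ((2 ^ q * j + k) / 2 ^ q)) =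
      treeChar m q fun _ => c (q + p) * l j :=
    treeChar_congr q fun k hk => by
      rw [Nat.mul_add_div (by positivity), Nat.div_eq_of_lt hk, add_zero]
  rw [hprod, tendsto_iff_norm_sub_tendsto_zero]
  refine squeeze_zero (fun _ => norm_nonneg _)
    (fun q => norm_treeChar_sub_prod_le (hm.trans (by norm_num)) q p _ _ fun j => ?_) ?_
  · rw [abs_of_pos (Real.exp_pos _), Real.exp_le_one_iff, neg_nonpos]
    positivity
  · simp_rw [hconst]
    refine (tendsto_finsetSum (a := fun _ => (0 : ℝ)) _ fun j _ => ?_).trans (by simp)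
    rw [← tendsto_iff_norm_sub_tendsto_zero]
    refine h.tendsto_treeChar_const hm (c := fun q => c (q + p) * l j) ?_
    have hvar := (tendsto_sq_mul_walkMoment_two hm hc p).const_mul (l j ^ 2)
    rw [mul_one_div] at hvar
    exact hvar.congr fun q => by ring

end IsSignFamily

end CentralLimit

/-! ### Wiener measure and dyadic increments -/

section Grid

/-- The dyadic point `j / 2 ^ p` of `[0,1]`, projected to `[0,1]` if `j > 2 ^ p`. -/
def gridPoint (p j : ℕ) : unitInterval :=
  Set.projIcc 0 1 zero_le_one ((j : ℝ) / 2 ^ p)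

/-- The increment of a path over the `j`-th dyadic interval of level `p`. -/
def gridIncr (p j : ℕ) (f : C(unitInterval, ℝ)) : ℝ :=
  f (gridPoint p (j + 1)) - f (gridPoint p j)

/-- The linear combination of the initial value of a path, with coefficient `a`, and of its dyadic
increments of level `p`, with coefficients `l j`. -/
def gridSum (p : ℕ) (a : ℝ) (l : ℕ → ℝ) (f : C(unitInterval, ℝ)) : ℝ :=
  a * f 0 + ∑ j ∈ Finset.range (2 ^ p), l j * gridIncr p j f

theorem continuous_gridSum (p : ℕ) (a : ℝ) (l : ℕ → ℝ) : Continuous (gridSum p a l) := by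
  have (t : unitInterval) : Continuous fun f : C(unitInterval, ℝ) => f t :=
    continuous_eval_const t
  unfold gridSum gridIncr
  fun_prop

theorem measurable_gridIncr (p j : ℕ) : Measurable (gridIncr p j) :=
  ((continuous_eval_const _).sub (continuous_eval_const _)).measurable

theorem gridPoint_zero (p : ℕ) : gridPoint p 0 = 0 := by
  simp [gridPoint, Set.projIcc_left]

theorem coe_gridPoint {p j : ℕ} (h : j ≤ 2 ^ p) : (gridPoint p j : ℝ) = j / 2 ^ p := by
  rw [gridPoint, Set.projIcc_of_mem zero_le_one]
  exact ⟨by positivity, div_le_one_of_le₀ (by exact_mod_cast h) (by positivity)⟩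

theorem floor_two_pow_mul_le (p : ℕ) (t : unitInterval) : ⌊2 ^ p * (t : ℝ)⌋₊ ≤ 2 ^ p := by
  refine Nat.floor_le_of_le ?_
  push_cast
  exact mul_le_of_le_one_right (by positivity) t.2.2

theorem tendsto_floor_two_pow_mul_div (t : unitInterval) :
    Tendsto (fun p : ℕ => (⌊2 ^ p * (t : ℝ)⌋₊ : ℝ) / 2 ^ p) atTop (𝓝 t) := by
  have h := (tendsto_nat_floor_mul_div_atTop (R := ℝ) t.2.1).comp
    (tendsto_pow_atTop_atTop_of_one_lt (r := (2 : ℝ)) one_lt_two)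
  simpa only [Function.comp_def, mul_comm (t : ℝ)] using h

theorem tendsto_gridPoint_floor (t : unitInterval) :
    Tendsto (fun p : ℕ => gridPoint p ⌊2 ^ p * (t : ℝ)⌋₊) atTop (𝓝 t) := by
  have h := (continuous_projIcc (h := zero_le_one (α := ℝ))).continuousAt.tendsto.comp
    (tendsto_floor_two_pow_mul_div t)
  rwa [Set.projIcc_val] at h

theorem apply_gridPoint_sub {p K₁ K₂ : ℕ} (h : K₁ ≤ K₂) (hK₂ : K₂ ≤ 2 ^ p)
    (f : C(unitInterval, ℝ)) :
    f (gridPoint p K₂) - f (gridPoint p K₁) =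
      ∑ j ∈ Finset.range (2 ^ p), if j ∈ Finset.Ico K₁ K₂ then gridIncr p j f else 0 := by
  have hsub : Finset.Ico K₁ K₂ ⊆ Finset.range (2 ^ p) := fun j hj =>
    Finset.mem_range.2 ((Finset.mem_Ico.1 hj).2.trans_le hK₂)
  rw [← Finset.sum_Ico_sub (fun j => f (gridPoint p j)) h, Finset.sum_ite_mem,
    Finset.inter_eq_right.2 hsub]
  rfl

theorem sum_mul_apply_gridPoint_sub {ι : Type*} [Fintype ι] {p : ℕ} (a : ι → ℝ) {K₁ K₂ : ι → ℕ}
    (h : ∀ i, K₁ i ≤ K₂ i) (hK₂ : ∀ i, K₂ i ≤ 2 ^ p) (f : C(unitInterval, ℝ)) :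
    ∑ i, a i * (f (gridPoint p (K₂ i)) - f (gridPoint p (K₁ i))) =
      gridSum p 0 (fun j => ∑ i, if j ∈ Finset.Ico (K₁ i) (K₂ i) then a i else 0) f := by
  simp_rw [apply_gridPoint_sub (h _) (hK₂ _), gridSum, Finset.mul_sum, Finset.sum_mul, mul_ite,
    ite_mul, mul_zero, zero_mul, zero_add]
  exact Finset.sum_comm

theorem exists_gridSum_eq_sum_mul_apply {ι : Type*} [Fintype ι] {p : ℕ} (a : ι → ℝ) {K : ι → ℕ}
    (hK : ∀ i, K i ≤ 2 ^ p) :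
    ∃ b l, ∀ f : C(unitInterval, ℝ), ∑ i, a i * f (gridPoint p (K i)) = gridSum p b l f := by
  refine ⟨∑ i, a i, fun j => ∑ i, if j ∈ Finset.Ico 0 (K i) then a i else 0, fun f => ?_⟩
  have h := sum_mul_apply_gridPoint_sub a (fun i => Nat.zero_le (K i)) hK f
  simp only [gridSum, mul_sub, Finset.sum_sub_distrib, ← Finset.sum_mul, zero_mul, zero_add,
    gridPoint_zero] at h ⊢
  rw [← h, add_sub_cancel]

theorem sum_sq_sum_ite_mem {ι κ : Type*} [Fintype ι] [DecidableEq κ] {s : Finset κ}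
    {A : ι → Finset κ} (hA : ∀ i, A i ⊆ s) (hdisj : Pairwise (Function.onFun Disjoint A))
    (a : ι → ℝ) :
    ∑ j ∈ s, (∑ i, if j ∈ A i then a i else 0) ^ 2 = ∑ i, a i ^ 2 * (A i).card := by
  have hsq (j : κ) :
      (∑ i, if j ∈ A i then a i else 0) ^ 2 = ∑ i, if j ∈ A i then a i ^ 2 else 0 := by
    by_cases hj : ∃ i, j ∈ A i
    · obtain ⟨i, hi⟩ := hj
      have hne (k : ι) (hk : k ≠ i) : j ∉ A k := fun hjk =>
        Finset.disjoint_left.1 (hdisj hk) hjk hi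
      rw [Finset.sum_eq_single i (fun k _ hk => if_neg (hne k hk)) (by simp),
        Finset.sum_eq_single i (fun k _ hk => if_neg (hne k hk)) (by simp), if_pos hi, if_pos hi]
    · push Not at hj
      simp [hj]
  simp_rw [hsq]
  rw [Finset.sum_comm]
  refine Finset.sum_congr rfl fun i _ => ?_
  rw [Finset.sum_ite_mem, Finset.inter_eq_right.2 (hA i), Finset.sum_const, nsmul_eq_mul, mul_comm]

end Grid

section Characterization

theorem tendsto_integral_exp_mul_I {α : Type*} [MeasurableSpace α] (W : Measure α)
    [IsFiniteMeasure W] {g : ℕ → α → ℝ} {G : α → ℝ} (hg : ∀ n, Measurable (g n))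
    (hlim : ∀ x, Tendsto (fun n => g n x) atTop (𝓝 (G x))) :
    Tendsto (fun n => ∫ x, Complex.exp (g n x * Complex.I) ∂W) atTop
      (𝓝 (∫ x, Complex.exp (G x * Complex.I) ∂W)) := by
  refine tendsto_integral_of_dominated_convergence (fun _ => 1) (fun n => ?_)
    (integrable_const _) (fun n => Eventually.of_forall fun x => ?_)
    (Eventually.of_forall fun x => ?_)
  · have := hg n
    fun_prop
  · exact (Complex.norm_exp_ofReal_mul_I _).le
  · exact (Complex.continuous_exp.tendsto _).comp
      (((Complex.continuous_ofReal.tendsto _).comp (hlim x)).mul_const _)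

/-- The joint characteristic functions under `W` of the initial value and of the dyadic increments
of a path are those of the Brownian motion: the initial value is `0`, and the increments of level
`p` are independent, centered and Gaussian of variance `2⁻ᵖ`. -/
def HasBrownianGrid (W : Measure C(unitInterval, ℝ)) : Prop :=
  ∀ (p : ℕ) (a : ℝ) (l : ℕ → ℝ), ∫ f, Complex.exp (gridSum p a l f * Complex.I) ∂W =
    (Real.exp (-((∑ j ∈ Finset.range (2 ^ p), l j ^ 2) / 2 ^ p / 2)) : ℝ)

namespace HasBrownianGrid

variable {W : Measure C(unitInterval, ℝ)}

theorem integral_exp_grid_increments (hW : HasBrownianGrid W) {n p : ℕ} {K : Fin (n + 1) → ℕ}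
    (hK : Monotone K) (hKp : ∀ i, K i ≤ 2 ^ p) (a : Fin n → ℝ) :
    ∫ f, Complex.exp ((∑ i, a i *
      (f (gridPoint p (K i.succ)) - f (gridPoint p (K i.castSucc))) : ℝ) * Complex.I) ∂W =
      (Real.exp (-((∑ i, a i ^ 2 *
        ((K i.succ : ℝ) / 2 ^ p - K i.castSucc / 2 ^ p)) / 2)) : ℝ) := by
  have hstep (i : Fin n) : K i.castSucc ≤ K i.succ := hK i.castSucc_le_succ
  have hdisj : Pairwise
      (Function.onFun Disjoint fun i : Fin n => Finset.Ico (K i.castSucc) (K i.succ)) :=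
    (pairwise_disjoint_on _).2 fun i j hij => Finset.disjoint_left.2 fun k hki hkj => by
      have := hK (show i.succ ≤ j.castSucc from hij)
      rw [Finset.mem_Ico] at hki hkj
      omega
  simp_rw [sum_mul_apply_gridPoint_sub a hstep fun i => hKp i.succ]
  rw [hW, sum_sq_sum_ite_mem (fun i j hj => Finset.mem_range.2
    ((Finset.mem_Ico.1 hj).2.trans_le (hKp i.succ))) hdisj, Finset.sum_div]
  simp_rw [Nat.card_Ico, Nat.cast_sub (hstep _), ← sub_div, mul_div_assoc]

variable [IsProbabilityMeasure W]

theorem integral_exp_increments (hW : HasBrownianGrid W) {n : ℕ} {t : Fin (n + 1) → unitInterval}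
    (ht : Monotone t) (a : Fin n → ℝ) :
    ∫ f, Complex.exp ((∑ i, a i * (f (t i.succ) - f (t i.castSucc)) : ℝ) * Complex.I) ∂W =
      (Real.exp (-((∑ i, a i ^ 2 * ((t i.succ : ℝ) - t i.castSucc)) / 2)) : ℝ) := by
  have hmono (p : ℕ) : Monotone fun i => ⌊2 ^ p * (t i : ℝ)⌋₊ := fun i j hij =>
    Nat.floor_mono (mul_le_mul_of_nonneg_left (ht hij) (by positivity))
  have hleft := tendsto_integral_exp_mul_I W
    (g := fun p f => ∑ i, a i * (f (gridPoint p ⌊2 ^ p * (t (Fin.succ i) : ℝ)⌋₊) -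
      f (gridPoint p ⌊2 ^ p * (t (Fin.castSucc i) : ℝ)⌋₊)))
    (fun p => by fun_prop)
    (fun f => tendsto_finsetSum _ fun i _ =>
      (((f.continuous.tendsto _).comp (tendsto_gridPoint_floor (t i.succ))).sub
        ((f.continuous.tendsto _).comp (tendsto_gridPoint_floor (t i.castSucc)))).const_mul (a i))
  refine tendsto_nhds_unique (hleft.congr fun p =>
    hW.integral_exp_grid_increments (hmono p) (fun i => floor_two_pow_mul_le p (t i)) a) ?_
  refine (Complex.continuous_ofReal.tendsto _).comp ((Real.continuous_exp.tendsto _).comp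
    (Tendsto.neg (Tendsto.div_const (tendsto_finsetSum _ fun i _ => Tendsto.const_mul _ ?_) 2)))
  exact (tendsto_floor_two_pow_mul_div _).sub (tendsto_floor_two_pow_mul_div _)

theorem charFun_map_increment (hW : HasBrownianGrid W) {n : ℕ} {t : Fin (n + 1) → unitInterval}
    (ht : Monotone t) (i : Fin n) (u : ℝ) :
    charFun (W.map fun f => f (t i.succ) - f (t i.castSucc)) u =
      (Real.exp (-(u ^ 2 * ((t i.succ : ℝ) - t i.castSucc) / 2)) : ℝ) := by
  have h := hW.integral_exp_increments ht (Pi.single i u)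
  simp only [Pi.single_apply, ite_mul, ite_pow, zero_mul, zero_pow two_ne_zero,
    Finset.sum_ite_eq', Finset.mem_univ, if_true] at h
  rw [charFun_apply_real, integral_map (by fun_prop) (by fun_prop), ← h]
  push_cast
  rfl

theorem hasIndepIncrements (hW : HasBrownianGrid W) :
    HasIndepIncrements (fun (t : unitInterval) (f : C(unitInterval, ℝ)) => f t) W := by
  intro n t ht
  rw [iIndepFun_iff_charFun_pi (by fun_prop)]
  intro u
  rw [Finset.prod_congr rfl fun i _ => hW.charFun_map_increment ht i (u i), ← Complex.ofReal_prod,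
    ← Real.exp_sum, Finset.sum_neg_distrib, ← Finset.sum_div, ← hW.integral_exp_increments ht,
    charFun_apply, integral_map (by fun_prop) (by fun_prop)]
  simp only [PiLp.inner_apply, RCLike.inner_apply, conj_trivial]

theorem hasLaw_sub (hW : HasBrownianGrid W) {s t : unitInterval} (hst : s ≤ t) :
    HasLaw (fun f : C(unitInterval, ℝ) => f t - f s)
      (gaussianReal 0 (Real.toNNReal (t - s))) W := by
  have hmeas : AEMeasurable (fun f : C(unitInterval, ℝ) => f t - f s) W := by fun_prop
  have hmono : Monotone ![s, t] := by simpa [Fin.monotone_iff_le_succ] using hst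
  refine ⟨hmeas, ?_⟩
  have := Measure.isProbabilityMeasure_map hmeas
  refine Measure.ext_of_charFun (funext fun u => ?_)
  refine (hW.charFun_map_increment hmono 0 u).trans ?_
  rw [charFun_gaussianReal, Real.coe_toNNReal _ (sub_nonneg.2 hst)]
  push_cast
  ring_nf

theorem ae_apply_zero (hW : HasBrownianGrid W) : ∀ᵐ f ∂W, f 0 = 0 := by
  have hmeas : AEMeasurable (fun f : C(unitInterval, ℝ) => f 0) W :=
    (continuous_eval_const 0).aemeasurable
  have := Measure.isProbabilityMeasure_map hmeas
  have hlaw : W.map (fun f : C(unitInterval, ℝ) => f 0) = Measure.dirac 0 := by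
    refine Measure.ext_of_charFun (funext fun u => ?_)
    rw [charFun_apply_real, integral_map hmeas (by fun_prop), charFun_dirac]
    simpa [gridSum] using hW 0 u 0
  exact (HasLaw.mk hmeas hlaw).ae_eq_of_dirac

theorem isWienerMeasure (hW : HasBrownianGrid W) : IsWienerMeasure W where
  start_zero := hW.ae_apply_zero
  indep_increments := hW.hasIndepIncrements
  gaussian_increments _ _ hst := hW.hasLaw_sub hst

end HasBrownianGrid

theorem bernsteinApproximation_eq_sum_smul (n : ℕ) (f : C(unitInterval, ℝ)) :
    bernsteinApproximation n f = ∑ k : Fin (n + 1), f (bernstein.z k) • bernstein n k := by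
  ext x
  simp [bernsteinApproximation, mul_comm]

theorem exists_gridSum_eq_apply_bernsteinApproximation (L : StrongDual ℝ C(unitInterval, ℝ))
    (p : ℕ) : ∃ b l, ∀ f, L (bernsteinApproximation (2 ^ p) f) = gridSum p b l f := by
  have hz (k : Fin (2 ^ p + 1)) : bernstein.z k = gridPoint p k :=
    Subtype.ext (by rw [coe_gridPoint (Nat.lt_succ_iff.1 k.2), bernstein.z]; push_cast; rfl)
  obtain ⟨b, l, hbl⟩ := exists_gridSum_eq_sum_mul_apply (p := p)
    (fun k : Fin (2 ^ p + 1) => L (bernstein (2 ^ p) k)) fun k => Nat.lt_succ_iff.1 k.2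
  refine ⟨b, l, fun f => ?_⟩
  simp only [bernsteinApproximation_eq_sum_smul, map_sum, map_smul, smul_eq_mul, hz, ← hbl,
    mul_comm]

-- The Bernstein polynomials of order `2 ^ p` only involve the values at dyadic points, so that the
-- characteristic functional is a limit of characteristic functions of dyadic increments.
theorem HasBrownianGrid.unique {W W' : Measure C(unitInterval, ℝ)} [IsProbabilityMeasure W]
    [IsProbabilityMeasure W'] (hW : HasBrownianGrid W) (hW' : HasBrownianGrid W') : W = W' := by
  refine Measure.ext_of_charFunDual (funext fun L => ?_)
  choose b l hbl using exists_gridSum_eq_apply_bernsteinApproximation L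
  have hlim (f : C(unitInterval, ℝ)) :
      Tendsto (fun p => gridSum p (b p) (l p) f) atTop (𝓝 (L f)) := by
    simp_rw [← hbl]
    exact (L.continuous.tendsto _).comp ((bernsteinApproximation_uniform f).comp
      (tendsto_pow_atTop_atTop_of_one_lt one_lt_two))
  have hmeas (p : ℕ) : Measurable (gridSum p (b p) (l p)) := (continuous_gridSum _ _ _).measurable
  rw [charFunDual_apply, charFunDual_apply]
  refine tendsto_nhds_unique (tendsto_integral_exp_mul_I W hmeas hlim)
    ((tendsto_integral_exp_mul_I W' hmeas hlim).congr fun p => ?_)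
  rw [hW, hW']

theorem hasBrownianGrid_of_tendsto {μ : ℕ → ProbabilityMeasure C(unitInterval, ℝ)}
    {W : ProbabilityMeasure C(unitInterval, ℝ)} {F : Filter ℕ} [F.NeBot] (hμ : Tendsto μ F (𝓝 W))
    (hchar : ∀ (p : ℕ) (a : ℝ) (l : ℕ → ℝ),
      Tendsto (fun n => ∫ f, Complex.exp (gridSum p a l f * Complex.I) ∂(μ n : Measure _)) F
        (𝓝 (Real.exp (-((∑ j ∈ Finset.range (2 ^ p), l j ^ 2) / 2 ^ p / 2)) : ℝ))) :
    HasBrownianGrid (W : Measure C(unitInterval, ℝ)) := by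
  intro p a l
  have hcont : Continuous fun f => Complex.exp (gridSum p a l f * Complex.I) := by
    have := continuous_gridSum p a l
    fun_prop
  have hlim := (ProbabilityMeasure.tendsto_iff_forall_integral_rclike_tendsto ℂ).1 hμ
    (BoundedContinuousFunction.ofNormedAddCommGroup _ hcont 1 fun f =>
      (Complex.norm_exp_ofReal_mul_I _).le)
  exact tendsto_nhds_unique hlim (hchar p a l)

theorem exists_isWienerMeasure_tendsto {μ : ℕ → ProbabilityMeasure C(unitInterval, ℝ)}
    (htight : IsTightMeasureSet {((ν : ProbabilityMeasure C(unitInterval, ℝ)) :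
      Measure C(unitInterval, ℝ)) | ν ∈ Set.range μ})
    (hchar : ∀ (p : ℕ) (a : ℝ) (l : ℕ → ℝ),
      Tendsto (fun n => ∫ f, Complex.exp (gridSum p a l f * Complex.I) ∂(μ n : Measure _)) atTop
        (𝓝 (Real.exp (-((∑ j ∈ Finset.range (2 ^ p), l j ^ 2) / 2 ^ p / 2)) : ℝ))) :
    ∃ W : ProbabilityMeasure C(unitInterval, ℝ),
      IsWienerMeasure (W : Measure C(unitInterval, ℝ)) ∧ Tendsto μ atTop (𝓝 W) := by
  have hlim (U : Ultrafilter ℕ) (hU : (U : Filter ℕ) ≤ atTop) :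
      ∃ W : ProbabilityMeasure C(unitInterval, ℝ),
        HasBrownianGrid (W : Measure C(unitInterval, ℝ)) ∧ Tendsto μ U (𝓝 W) := by
    obtain ⟨W, -, hW⟩ := (isCompact_closure_of_isTightMeasureSet htight).ultrafilter_le_nhds
      (U.map μ)
      (le_principal_iff.2 (mem_map.2 (Eventually.of_forall fun n => subset_closure ⟨n, rfl⟩)))
    exact ⟨W, hasBrownianGrid_of_tendsto hW fun p a l => (hchar p a l).mono_left hU, hW⟩
  obtain ⟨W, hW, -⟩ := hlim (Ultrafilter.of atTop) (Ultrafilter.of_le _)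
  refine ⟨W, hW.isWienerMeasure, (tendsto_iff_ultrafilter _ _ _).2 fun U hU => ?_⟩
  obtain ⟨W', hW', hlim'⟩ := hlim U hU
  have hWW' : (W' : Measure C(unitInterval, ℝ)) = W := hW'.unique hW
  rwa [Subtype.ext hWW'] at hlim'

end Characterization

/-! ### Tightness from moments of the dyadic increments -/

section Tightness

open scoped NNReal ENNReal

/-- The paths starting from `0` whose dyadic increments of level `p` are at most `M * θ ^ p`, for
all `p`. For `θ < 1` they form a compact set of Hölder continuous paths. -/
def dyadicHolderPaths (M θ : ℝ≥0) : Set C(unitInterval, ℝ) :=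
  {f | f 0 = 0 ∧ ∀ p, ∀ j < 2 ^ p, |gridIncr p j f| ≤ M * θ ^ p}

theorem isClosed_dyadicHolderPaths (M θ : ℝ≥0) : IsClosed (dyadicHolderPaths M θ) := by
  simp only [dyadicHolderPaths, Set.ofPred_and, Set.ofPred_forall]
  refine (isClosed_eq (continuous_eval_const 0) continuous_const).inter ?_
  exact isClosed_iInter fun p => isClosed_iInter fun j => isClosed_iInter fun _ =>
    isClosed_le ((continuous_eval_const _).sub (continuous_eval_const _)).abs continuous_const

theorem gridPoint_succ_two_mul (p j : ℕ) : gridPoint (p + 1) (2 * j) = gridPoint p j := by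
  rw [gridPoint, gridPoint, pow_succ', Nat.cast_mul, Nat.cast_ofNat,
    mul_div_mul_left _ _ two_ne_zero]

theorem floor_two_pow_mul_eq_div_two (p : ℕ) (t : ℝ) :
    ⌊2 ^ p * t⌋₊ = ⌊2 ^ (p + 1) * t⌋₊ / 2 := by
  rw [← Nat.floor_div_ofNat, pow_succ', mul_assoc, mul_div_cancel_left₀ _ two_ne_zero]

section Paths

variable {M θ : ℝ≥0} {f : C(unitInterval, ℝ)}

theorem dist_apply_gridPoint_div_two_le (hf : f ∈ dyadicHolderPaths M θ) {p j : ℕ}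
    (hj : j ≤ 2 ^ (p + 1)) :
    dist (f (gridPoint p (j / 2))) (f (gridPoint (p + 1) j)) ≤ M * θ ^ (p + 1) := by
  rw [← gridPoint_succ_two_mul]
  rcases j.even_or_odd' with ⟨k, rfl | rfl⟩
  · rw [Nat.mul_div_cancel_left _ two_pos, dist_self]
    positivity
  · rw [show (2 * k + 1) / 2 = k by omega, dist_comm, Real.dist_eq]
    exact hf.2 (p + 1) (2 * k) (by omega)

theorem dist_apply_gridPoint_floor_le (hθ : θ < 1) (hf : f ∈ dyadicHolderPaths M θ)
    (t : unitInterval) (p : ℕ) :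
    dist (f (gridPoint p ⌊2 ^ p * (t : ℝ)⌋₊)) (f t) ≤ M * θ ^ p / (1 - θ) := by
  refine dist_le_of_le_geometric_of_tendsto θ M (by exact_mod_cast hθ) (fun q => ?_)
    ((f.continuous.tendsto _).comp (tendsto_gridPoint_floor t)) p
  rw [Function.comp_apply, Function.comp_apply, floor_two_pow_mul_eq_div_two q]
  refine (dist_apply_gridPoint_div_two_le hf (floor_two_pow_mul_le (q + 1) t)).trans ?_
  exact mul_le_mul_of_nonneg_left
    (pow_le_pow_of_le_one θ.2 (by exact_mod_cast hθ.le) q.le_succ) M.2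

theorem dist_apply_gridPoint_le (hf : f ∈ dyadicHolderPaths M θ) {p j k : ℕ} (hj : j ≤ 2 ^ p)
    (hk : k ≤ 2 ^ p) (hjk : j ≤ k + 1) (hkj : k ≤ j + 1) :
    dist (f (gridPoint p j)) (f (gridPoint p k)) ≤ M * θ ^ p := by
  rcases (by omega : j = k ∨ j = k + 1 ∨ k = j + 1) with rfl | rfl | rfl
  · rw [dist_self]
    positivity
  · exact hf.2 p k (by omega)
  · rw [dist_comm]
    exact hf.2 p j (by omega)

theorem floor_two_pow_mul_le_add_one {s t : unitInterval} {p : ℕ} (hst : dist s t ≤ 1 / 2 ^ p) :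
    ⌊2 ^ p * (s : ℝ)⌋₊ ≤ ⌊2 ^ p * (t : ℝ)⌋₊ + 1 := by
  have ht : (0 : ℝ) ≤ 2 ^ p * t := mul_nonneg (by positivity) t.2.1
  rw [← Nat.floor_add_one ht]
  refine Nat.floor_mono ?_
  rw [le_div_iff₀' (by positivity), Subtype.dist_eq, Real.dist_eq] at hst
  nlinarith [le_abs_self ((s : ℝ) - t), pow_pos (two_pos (α := ℝ)) p]

theorem dist_apply_le (hθ : θ < 1) (hf : f ∈ dyadicHolderPaths M θ) {s t : unitInterval} {p : ℕ}
    (hst : dist s t ≤ 1 / 2 ^ p) : dist (f s) (f t) ≤ M * (1 + 2 / (1 - θ)) * θ ^ p := by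
  have hs := dist_apply_gridPoint_floor_le hθ hf s p
  have ht := dist_apply_gridPoint_floor_le hθ hf t p
  have hmid := dist_apply_gridPoint_le hf (floor_two_pow_mul_le p s) (floor_two_pow_mul_le p t)
    (floor_two_pow_mul_le_add_one hst) (floor_two_pow_mul_le_add_one (by rwa [dist_comm]))
  rw [dist_comm] at hs
  calc dist (f s) (f t)
      ≤ M * θ ^ p / (1 - θ) + M * θ ^ p + M * θ ^ p / (1 - θ) :=
        (dist_triangle4 _ _ _ _).trans (add_le_add (add_le_add hs hmid) ht)
    _ = M * (1 + 2 / (1 - θ)) * θ ^ p := by ring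

end Paths

theorem equicontinuous_dyadicHolderPaths (M : ℝ≥0) {θ : ℝ≥0} (hθ : θ < 1) :
    Equicontinuous fun f : dyadicHolderPaths M θ => ⇑f.1 := by
  intro t
  rw [Metric.equicontinuousAt_iff_right]
  intro η hη
  have hlim : Tendsto (fun p : ℕ => M * (1 + 2 / (1 - θ)) * (θ : ℝ) ^ p) atTop (𝓝 0) := by
    simpa using (tendsto_pow_atTop_nhds_zero_of_lt_one θ.2 (by exact_mod_cast hθ)).const_mul
      (M * (1 + 2 / (1 - θ)) : ℝ)
  obtain ⟨p, hp⟩ := (hlim.eventually_lt_const hη).exists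
  filter_upwards [Metric.closedBall_mem_nhds t (ε := 1 / 2 ^ p) (by positivity)] with s hs f
  exact (dist_apply_le hθ f.2 (by rwa [dist_comm])).trans_lt hp

theorem isCompact_dyadicHolderPaths (M : ℝ≥0) {θ : ℝ≥0} (hθ : θ < 1) :
    IsCompact (dyadicHolderPaths M θ) := by
  let e := ContinuousMap.isometryEquivBoundedOfCompact unitInterval ℝ
  have hbound (f : C(unitInterval, ℝ)) (t : unitInterval) (hf : f ∈ dyadicHolderPaths M θ) :
      f t ∈ Metric.closedBall (0 : ℝ) (M * (1 + 2 / (1 - θ))) := by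
    have ht : dist t 0 ≤ 1 / 2 ^ 0 := by
      simpa [Subtype.dist_eq, Real.dist_eq, abs_of_nonneg t.2.1] using t.2.2
    simpa [hf.1] using dist_apply_le hθ hf ht
  have hcompact : IsCompact (e.symm ⁻¹' dyadicHolderPaths M θ) := by
    refine BoundedContinuousFunction.arzela_ascoli₂ _ (isCompact_closedBall _ _) _
      ((isClosed_dyadicHolderPaths M θ).preimage e.symm.continuous)
      (fun g t hg => hbound (e.symm g) t hg) ?_
    exact (equicontinuous_dyadicHolderPaths M hθ).comp
      fun g : e.symm ⁻¹' dyadicHolderPaths M θ => ⟨e.symm g.1, g.2⟩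
  rw [← Set.image_preimage_eq (dyadicHolderPaths M θ) e.symm.surjective]
  exact hcompact.image e.symm.continuous

section Measure

variable {μ : Measure C(unitInterval, ℝ)} {C ρ : ℝ≥0∞} {k : ℕ}

theorem measure_iUnion_lt_abs_gridIncr_le {M θ : ℝ≥0} (hM : M ≠ 0) (hθ : θ ≠ 0) {p : ℕ}
    (hμ : ∀ j < 2 ^ p, ∫⁻ f, ‖gridIncr p j f‖ₑ ^ k ∂μ ≤ C * ρ ^ p) :
    μ (⋃ j ∈ Finset.range (2 ^ p), {f | M * θ ^ p < |gridIncr p j f|}) ≤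
      C / M ^ k * (2 * ρ / θ ^ k) ^ p := by
  have hmarkov (j : ℕ) (hj : j ∈ Finset.range (2 ^ p)) :
      μ {f | M * θ ^ p < |gridIncr p j f|} ≤ C * ρ ^ p / (M * θ ^ p) ^ k := by
    have hsub : {f | M * θ ^ p < |gridIncr p j f|} ⊆
        {f | ((M : ℝ≥0∞) * θ ^ p) ^ k ≤ ‖gridIncr p j f‖ₑ ^ k} := fun f hf => by
      have hlt : M * θ ^ p < ‖gridIncr p j f‖₊ := by exact_mod_cast hf
      have hle : (M : ℝ≥0∞) * θ ^ p ≤ ‖gridIncr p j f‖ₑ := by exact_mod_cast hlt.le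
      exact pow_le_pow_left' hle k
    refine (measure_mono hsub).trans ((meas_ge_le_lintegral_div
      ((measurable_gridIncr p j).enorm.pow_const k).aemeasurable ?_ ?_).trans
      (ENNReal.div_le_div_right (hμ j (Finset.mem_range.1 hj)) _))
    · simp [hM, hθ]
    · finiteness
  refine (measure_biUnion_finset_le _ _).trans ((Finset.sum_le_sum hmarkov).trans_eq ?_)
  have hpow : ((M : ℝ≥0∞) * θ ^ p) ^ k = M ^ k * (θ ^ k) ^ p := by ring
  rw [Finset.sum_const, Finset.card_range, nsmul_eq_mul, hpow, div_eq_mul_inv, div_eq_mul_inv,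
    div_eq_mul_inv, ENNReal.mul_inv (by simp [hM]) (by simp),
    ENNReal.inv_pow (a := (θ : ℝ≥0∞) ^ k)]
  push_cast
  ring

theorem measure_compl_dyadicHolderPaths_le {M θ : ℝ≥0} (hM : M ≠ 0) (hθ : θ ≠ 0)
    (h0 : ∀ᵐ f ∂μ, f 0 = 0)
    (hμ : ∀ p, ∀ j < 2 ^ p, ∫⁻ f, ‖gridIncr p j f‖ₑ ^ k ∂μ ≤ C * ρ ^ p) :
    μ (dyadicHolderPaths M θ)ᶜ ≤ C / M ^ k * (1 - 2 * ρ / θ ^ k)⁻¹ := by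
  have hsub : (dyadicHolderPaths M θ)ᶜ ⊆ {f | ¬ f 0 = 0} ∪
      ⋃ p : ℕ, ⋃ j ∈ Finset.range (2 ^ p), {f | M * θ ^ p < |gridIncr p j f|} := by
    intro f hf
    by_contra hnot
    simp only [Set.mem_union, Set.mem_iUnion, Set.mem_ofPred_eq, Finset.mem_range] at hnot
    push Not at hnot
    exact hf hnot
  calc μ (dyadicHolderPaths M θ)ᶜ
      ≤ 0 + ∑' p : ℕ, C / M ^ k * (2 * ρ / θ ^ k) ^ p :=
        (measure_mono hsub).trans ((measure_union_le _ _).trans (add_le_add (le_of_eq h0)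
          ((measure_iUnion_le _).trans (ENNReal.tsum_le_tsum fun p =>
            measure_iUnion_lt_abs_gridIncr_le hM hθ (hμ p)))))
    _ = C / M ^ k * (1 - 2 * ρ / θ ^ k)⁻¹ := by
        rw [zero_add, ENNReal.tsum_mul_left, ENNReal.tsum_geometric]

-- A Kolmogorov-type criterion: Markov's inequality for the `2 ^ p` increments of each level `p`
-- gives a geometric series of ratio `2 * ρ / θ ^ k`, and `θ < 1` is chosen close to `1`.
theorem isTightMeasureSet_of_lintegral_gridIncr_pow_le {S : Set (Measure C(unitInterval, ℝ))}
    (hk : k ≠ 0) (hC : C ≠ ∞) (hρ : 2 * ρ < 1) (h0 : ∀ μ ∈ S, ∀ᵐ f ∂μ, f 0 = 0)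
    (hS : ∀ μ ∈ S, ∀ p, ∀ j < 2 ^ p, ∫⁻ f, ‖gridIncr p j f‖ₑ ^ k ∂μ ≤ C * ρ ^ p) :
    IsTightMeasureSet S := by
  have hpow : Tendsto (fun θ : ℝ≥0 => (θ : ℝ≥0∞) ^ k) (𝓝[<] 1) (𝓝 1) := by
    have hcont : Continuous fun θ : ℝ≥0 => (θ : ℝ≥0∞) ^ k := by fun_prop
    simpa using (hcont.tendsto 1).mono_left nhdsWithin_le_nhds
  have : (𝓝[<] (1 : ℝ≥0)).NeBot := nhdsLT_neBot_of_exists_lt ⟨0, one_pos⟩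
  obtain ⟨θ, hρθ, hθ⟩ := ((hpow.eventually_const_lt hρ).and self_mem_nhdsWithin).exists
  have hθ0 : θ ≠ 0 := by
    rintro rfl
    simp [hk] at hρθ
  have hratio : 2 * ρ / θ ^ k < 1 := ENNReal.div_lt_of_lt_mul' (by simpa using hρθ)
  have hlim : Tendsto (fun M : ℝ≥0 => C / M ^ k * (1 - 2 * ρ / θ ^ k)⁻¹) atTop (𝓝 0) := by
    have hMk : Tendsto (fun M : ℝ≥0 => (M : ℝ≥0∞) ^ k) atTop (𝓝 ∞) := by
      simp_rw [← ENNReal.coe_pow]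
      exact ENNReal.tendsto_coe_nhds_top.2 (tendsto_pow_atTop hk)
    have hdiv := ENNReal.Tendsto.const_div hMk (Or.inr hC)
    simpa using ENNReal.Tendsto.mul_const hdiv
      (Or.inr (ENNReal.inv_ne_top.2 (tsub_pos_of_lt hratio).ne'))
  rw [isTightMeasureSet_iff_exists_isCompact_measure_compl_le]
  intro η hη
  obtain ⟨M, hM, hM0⟩ := ((hlim.eventually_lt_const hη).and (eventually_gt_atTop 0)).exists
  exact ⟨dyadicHolderPaths M θ, isCompact_dyadicHolderPaths M hθ, fun μ hμ =>
    (measure_compl_dyadicHolderPaths_le hM0.ne' hθ0 (h0 μ hμ) (hS μ hμ)).trans hM.le⟩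

end Measure

end Tightness

/-! ### Dyadic increments of the interpolated walk -/

section Interp

variable (e : List Bool → ℝ)

theorem interp_gridPoint (q : ℕ) {p j : ℕ} (hj : j ≤ 2 ^ p) :
    interp e (q + p) (gridPoint p j) = walk e (q + p) (2 ^ q * j) := by
  have hfloor : (2 : ℝ) ^ (q + p) * gridPoint p j = (2 ^ q * j : ℕ) := by
    rw [coe_gridPoint hj, pow_add]
    push_cast
    field_simp
  change interpFun e (q + p) (gridPoint p j) = _
  rw [interpFun, hfloor, Nat.floor_natCast, sub_self, zero_mul, add_zero]

theorem interp_zero (n : ℕ) : interp e n 0 = 0 := by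
  simpa [gridPoint_zero, walk] using interp_gridPoint e n (p := 0) (Nat.zero_le _)

theorem gridIncr_interp (q : ℕ) {p j : ℕ} (hj : j < 2 ^ p) :
    gridIncr p j (interp e (q + p)) =
      signProd e (dyadicWord p j) * walk (subtree e (dyadicWord p j)) q (2 ^ q) := by
  rw [gridIncr, interp_gridPoint e q hj, interp_gridPoint e q hj.le, walk_two_pow_mul_sub]

theorem gridIncr_smul (p j : ℕ) (c : ℝ) (f : C(unitInterval, ℝ)) :
    gridIncr p j (c • f) = c * gridIncr p j f := by
  simp [gridIncr, mul_sub]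

theorem sum_range_mul_eq_sum_blocks (f : ℕ → ℝ) (a b : ℕ) :
    ∑ k ∈ Finset.range (a * b), f k =
      ∑ j ∈ Finset.range b, ∑ i ∈ Finset.range a, f (a * j + i) := by
  induction b with
  | zero => simp
  | succ b ih => rw [mul_add_one, Finset.sum_range_add, ih, Finset.sum_range_succ]

theorem gridSum_smul_interp (q p : ℕ) (a c : ℝ) (l : ℕ → ℝ) :
    gridSum p a l (c • interp e (q + p)) = stepSum e (q + p) fun k => c * l (k / 2 ^ q) := by
  rw [gridSum, ContinuousMap.smul_apply, interp_zero, smul_zero, mul_zero, zero_add, stepSum,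
    pow_add, sum_range_mul_eq_sum_blocks]
  refine Finset.sum_congr rfl fun j hj => ?_
  rw [gridIncr_smul, gridIncr_interp e q (Finset.mem_range.1 hj), walk, Finset.mul_sum,
    Finset.mul_sum, Finset.mul_sum]
  refine Finset.sum_congr rfl fun k hk => ?_
  have hk := Finset.mem_range.1 hk
  rw [step_two_pow_mul_add e hk, Nat.mul_add_div (by positivity), Nat.div_eq_of_lt hk, add_zero]
  ring

variable {e}

theorem abs_interp_sub_le (he : ∀ w, |e w| = 1) (n : ℕ) {s t : unitInterval} (hst : s ≤ t) :
    |interp e n t - interp e n s| ≤ 2 ^ n * (t - s) := by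
  -- The tent functions add up to `2 ^ n * t`, the interpolated walk when all the signs are `1`.
  have hsum (t : unitInterval) :
      2 ^ n * (t : ℝ) = ∑ k ∈ Finset.range (2 ^ n + 1), max 0 (min 1 (2 ^ n * (t : ℝ) - k)) := by
    simpa [interpFun, walk, step, signProd] using interpFun_eq_sum (fun _ => 1) n t.2.1 t.2.2
  have hsub := congrArg₂ (· - ·) (hsum t) (hsum s)
  rw [← mul_sub, ← Finset.sum_sub_distrib] at hsub
  change |interpFun e n t - interpFun e n s| ≤ _
  rw [interpFun_eq_sum e n t.2.1 t.2.2, interpFun_eq_sum e n s.2.1 s.2.2, hsub,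
    ← Finset.sum_sub_distrib]
  refine (Finset.abs_sum_le_sum_abs _ _).trans (Finset.sum_le_sum fun k _ => ?_)
  have hstep : |step e n k| = 1 := by
    rw [step, signProd, Finset.abs_prod, Finset.prod_eq_one fun i _ => he _]
  have hst' : (s : ℝ) ≤ t := hst
  rw [← sub_mul, abs_mul, hstep, mul_one, abs_of_nonneg (sub_nonneg.2 (by gcongr))]

theorem abs_gridIncr_interp_le (he : ∀ w, |e w| = 1) (n r : ℕ) {j : ℕ} (hj : j < 2 ^ (n + r)) :
    |gridIncr (n + r) j (interp e n)| ≤ (1 / 2) ^ r := by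
  have hmono : gridPoint (n + r) j ≤ gridPoint (n + r) (j + 1) :=
    Set.monotone_projIcc _ (by gcongr; simp)
  refine (abs_interp_sub_le he n hmono).trans_eq ?_
  rw [coe_gridPoint hj, coe_gridPoint hj.le, pow_add, div_pow, one_pow]
  push_cast
  field_simp
  ring

theorem measurable_interp {Ω : Type*} [MeasurableSpace Ω] {ε : List Bool → Ω → ℝ}
    (hε : ∀ w, Measurable (ε w)) (n : ℕ) : Measurable fun ω => interp (fun w => ε w ω) n := by
  have htents (ω : Ω) : interp (fun w => ε w ω) n = ∑ k ∈ Finset.range (2 ^ n + 1),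
      step (fun w => ε w ω) n k •
        (⟨fun t => max 0 (min 1 (2 ^ n * (t : ℝ) - k)), by fun_prop⟩ : C(unitInterval, ℝ)) := by
    ext t
    rw [ContinuousMap.sum_apply]
    refine (interpFun_eq_sum _ n t.2.1 t.2.2).trans (Finset.sum_congr rfl fun k _ => ?_)
    exact mul_comm _ _
  have hstep (k : ℕ) : Measurable fun ω => step (fun w => ε w ω) n k := by
    unfold step signProd
    fun_prop
  have hsmul (g : C(unitInterval, ℝ)) : Measurable fun x : ℝ => x • g :=
    (continuous_id.smul continuous_const).measurable
  simp_rw [htents]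
  exact Finset.measurable_sum _ fun k _ => (hsmul _).comp (hstep k)

end Interp

/-! ### Convergence to Brownian motion -/

theorem enorm_pow_four (x : ℝ) : ‖x‖ₑ ^ 4 = ENNReal.ofReal (x ^ 4) := by
  rw [Real.enorm_eq_ofReal_abs, ← ENNReal.ofReal_pow (abs_nonneg x), Even.pow_abs (by decide)]

namespace IsSignFamily

variable {Ω : Type*} [MeasurableSpace Ω] {P : Measure Ω} {m : ℝ} {ε : List Bool → Ω → ℝ}

variable [IsProbabilityMeasure P]

theorem lintegral_gridIncr_interp_pow_four (h : IsSignFamily P m ε) (q : ℕ) {p j : ℕ}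
    (hj : j < 2 ^ p) :
    ∫⁻ ω, ‖gridIncr p j (interp (fun w => ε w ω) (q + p))‖ₑ ^ 4 ∂P =
      ENNReal.ofReal (walkMoment m q 4) := by
  have hsub := h.subtree (dyadicWord p j)
  rw [← hsub.integral_walk_pow, ofReal_integral_eq_lintegral_ofReal (hsub.integrable_walk_pow q 4)
    (Eventually.of_forall fun ω => by positivity)]
  refine lintegral_congr fun ω => ?_
  rw [gridIncr_interp _ q hj, enorm_mul, Real.enorm_eq_ofReal_abs (signProd _ _),
    h.abs_signProd, ENNReal.ofReal_one, one_mul, enorm_pow_four]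
  rfl

theorem lintegral_gridIncr_interp_pow_four_le (h : IsSignFamily P m ε) (hm : m ^ 2 ≤ 1 / 2)
    (n : ℕ) {p j : ℕ} (hj : j < 2 ^ p) :
    ∫⁻ ω, ‖gridIncr p j (interp (fun w => ε w ω) n)‖ₑ ^ 4 ∂P ≤
      ENNReal.ofReal (9 * (walkMoment m n 2 * (1 / 2) ^ p) ^ 2) := by
  rcases le_total p n with hpn | hnp
  · obtain ⟨q, rfl⟩ := Nat.exists_eq_add_of_le' hpn
    rw [h.lintegral_gridIncr_interp_pow_four q hj]
    refine ENNReal.ofReal_le_ofReal ((h.walkMoment_four_le hm q).trans ?_)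
    have hpos := walkMoment_two_pos m q
    gcongr
    rw [div_pow, one_pow, mul_one_div, le_div_iff₀' (by positivity)]
    exact two_pow_mul_walkMoment_two_le m q p
  · obtain ⟨r, rfl⟩ := Nat.exists_eq_add_of_le hnp
    have hpt (ω : Ω) : ‖gridIncr (n + r) j (interp (fun w => ε w ω) n)‖ₑ ^ 4 ≤
        ENNReal.ofReal (9 * (walkMoment m n 2 * (1 / 2) ^ (n + r)) ^ 2) := by
      rw [enorm_pow_four, ← Even.pow_abs (by decide)]
      refine ENNReal.ofReal_le_ofReal ?_
      have hincr := abs_gridIncr_interp_le (h.abs_eq_one · ω) n r hj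
      have hmom : (1 / 2 : ℝ) ^ r ≤ walkMoment m n 2 * (1 / 2) ^ (n + r) :=
        calc (1 / 2 : ℝ) ^ r = 2 ^ n * (1 / 2) ^ (n + r) := by
              rw [pow_add, ← mul_assoc, ← mul_pow]; norm_num
          _ ≤ _ := by gcongr; exact two_pow_le_walkMoment_two m n
      have hle_one : ((1 / 2 : ℝ) ^ r) ^ 2 ≤ 1 := by
        rw [← pow_mul]
        exact pow_le_one₀ (by norm_num) (by norm_num)
      calc |gridIncr (n + r) j (interp (fun w => ε w ω) n)| ^ 4 ≤ ((1 / 2) ^ r) ^ 4 := by gcongr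
        _ ≤ 9 * ((1 / 2) ^ r) ^ 2 := by nlinarith [sq_nonneg ((1 / 2 : ℝ) ^ r)]
        _ ≤ 9 * (walkMoment m n 2 * (1 / 2) ^ (n + r)) ^ 2 := by gcongr
    exact (lintegral_mono hpt).trans_eq (by simp)

theorem measurable_smul_interp (hε : ∀ w, Measurable (ε w)) (c : ℝ) (n : ℕ) :
    Measurable fun ω => c • interp (fun w => ε w ω) n :=
  (continuous_const_smul c).measurable.comp (measurable_interp hε n)

theorem isTightMeasureSet_map_smul_interp (h : IsSignFamily P m ε) (hm : m ^ 2 ≤ 1 / 2) {c : ℕ → ℝ}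
    (hc : BddAbove (Set.range fun n => c n ^ 2 * walkMoment m n 2)) :
    IsTightMeasureSet (Set.range fun n => P.map fun ω => c n • interp (fun w => ε w ω) n) := by
  obtain ⟨B, hB⟩ := hc
  refine isTightMeasureSet_of_lintegral_gridIncr_pow_le (k := 4) (C := ENNReal.ofReal (9 * B ^ 2))
    (ρ := ENNReal.ofReal (1 / 4)) (by simp) ENNReal.ofReal_ne_top ?_ ?_ ?_
  · rw [← ENNReal.ofReal_ofNat 2, ← ENNReal.ofReal_mul zero_le_two, ENNReal.ofReal_lt_one]
    norm_num
  · rintro _ ⟨n, rfl⟩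
    rw [ae_map_iff (measurable_smul_interp h.measurable _ n).aemeasurable
      (isClosed_eq (continuous_eval_const 0) continuous_const).measurableSet]
    exact Eventually.of_forall fun ω => by simp [interp_zero]
  · rintro _ ⟨n, rfl⟩ p j hj
    rw [lintegral_map ((measurable_gridIncr p j).enorm.pow_const 4)
      (measurable_smul_interp h.measurable _ n)]
    simp_rw [gridIncr_smul, enorm_mul, mul_pow]
    rw [lintegral_const_mul' _ _ (by finiteness)]
    calc ‖c n‖ₑ ^ 4 * ∫⁻ ω, ‖gridIncr p j (interp (fun w => ε w ω) n)‖ₑ ^ 4 ∂P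
        ≤ ENNReal.ofReal (c n ^ 4) *
            ENNReal.ofReal (9 * (walkMoment m n 2 * (1 / 2) ^ p) ^ 2) := by
          rw [enorm_pow_four]
          gcongr
          exact h.lintegral_gridIncr_interp_pow_four_le hm n hj
      _ = ENNReal.ofReal (9 * (c n ^ 2 * walkMoment m n 2) ^ 2 * (1 / 4) ^ p) := by
          rw [← ENNReal.ofReal_mul (by positivity), show (1 / 4 : ℝ) = (1 / 2) ^ 2 by norm_num,
            ← pow_mul, mul_comm 2 p]
          ring_nf
      _ ≤ ENNReal.ofReal (9 * B ^ 2 * (1 / 4) ^ p) := by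
          have hpos := walkMoment_two_pos m n
          gcongr
          exact hB ⟨n, rfl⟩
      _ = ENNReal.ofReal (9 * B ^ 2) * ENNReal.ofReal (1 / 4) ^ p := by
          rw [ENNReal.ofReal_mul (by positivity), ENNReal.ofReal_pow (by norm_num)]

theorem exists_isWienerMeasure_tendstoInDistribution (h : IsSignFamily P m ε)
    (hm : m ^ 2 ≤ 1 / 2) {c : ℕ → ℝ}
    (hc : Tendsto (fun n => c n ^ 2 * walkMoment m n 2) atTop (𝓝 1)) :
    ∃ W : ProbabilityMeasure C(unitInterval, ℝ),
      IsWienerMeasure (W : Measure C(unitInterval, ℝ)) ∧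
      TendstoInDistribution (fun (n : ℕ) (ω : Ω) => c n • interp (fun w => ε w ω) n)
        atTop (fun f : C(unitInterval, ℝ) => f) (fun _ => P)
        (W : Measure C(unitInterval, ℝ)) := by
  have hX (n : ℕ) : AEMeasurable (fun ω => c n • interp (fun w => ε w ω) n) P :=
    (measurable_smul_interp h.measurable (c n) n).aemeasurable
  let μ (n : ℕ) : ProbabilityMeasure C(unitInterval, ℝ) :=
    ⟨P.map fun ω => c n • interp (fun w => ε w ω) n, Measure.isProbabilityMeasure_map (hX n)⟩
  have htight : IsTightMeasureSet {((ν : ProbabilityMeasure C(unitInterval, ℝ)) :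
      Measure C(unitInterval, ℝ)) | ν ∈ Set.range μ} := by
    refine (h.isTightMeasureSet_map_smul_interp hm hc.bddAbove_range).subset ?_
    rintro _ ⟨_, ⟨n, rfl⟩, rfl⟩
    exact ⟨n, rfl⟩
  have hchar (p : ℕ) (a : ℝ) (l : ℕ → ℝ) :
      Tendsto (fun n => ∫ f, Complex.exp (gridSum p a l f * Complex.I) ∂(μ n : Measure _)) atTop
        (𝓝 (Real.exp (-((∑ j ∈ Finset.range (2 ^ p), l j ^ 2) / 2 ^ p / 2)) : ℝ)) := by
    rw [← tendsto_add_atTop_iff_nat p]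
    refine (h.tendsto_treeChar_block hm hc p l).congr fun q => ?_
    have hmeas : AEStronglyMeasurable (fun f => Complex.exp (gridSum p a l f * Complex.I))
        (μ (q + p)) := by
      have := (continuous_gridSum p a l).measurable
      fun_prop
    rw [← h.integral_exp_stepSum]
    simp_rw [← gridSum_smul_interp _ q p a]
    exact (integral_map (hX _) hmeas).symm
  obtain ⟨W, hW, hlim⟩ := exists_isWienerMeasure_tendsto htight hchar
  exact ⟨W, hW, hX, aemeasurable_id,
    hlim.trans_eq (congrArg 𝓝 (Subtype.ext Measure.map_id.symm))⟩

end IsSignFamily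

/-! ### The normalizing constants -/

section Normalization

theorem walkMoment_two_eq (m : ℝ) (n : ℕ) : walkMoment m n 2 =
    2 ^ n * (1 + m ^ 2 * ∑ j ∈ Finset.range n, (2 * m ^ 2) ^ j) := by
  induction n with
  | zero => simp [walkMoment]
  | succ n ih =>
    have hsq : ((2 * m) ^ n) ^ 2 = 2 ^ n * (2 * m ^ 2) ^ n := by
      rw [← pow_mul, mul_comm n 2, pow_mul, ← mul_pow]
      ring
    rw [walkMoment_two_succ, walkMoment_one, ih, hsq, Finset.sum_range_succ]
    ring

theorem tendsto_walkMoment_two_div_two_pow {m : ℝ} (hm : m ^ 2 < 1 / 2) :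
    Tendsto (fun n => walkMoment m n 2 / 2 ^ n) atTop (𝓝 (1 + m ^ 2 * (1 - 2 * m ^ 2)⁻¹)) := by
  have hgeom := hasSum_geometric_of_lt_one (r := 2 * m ^ 2) (by positivity) (by linarith)
  refine ((hgeom.tendsto_sum_nat.const_mul (m ^ 2)).const_add 1).congr fun n => ?_
  rw [walkMoment_two_eq, mul_div_cancel_left₀ _ (by positivity)]

theorem walkMoment_two_of_sq_eq_half {m : ℝ} (hm : m ^ 2 = 1 / 2) (n : ℕ) :
    walkMoment m n 2 = 2 ^ n * (1 + n / 2) := by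
  rw [walkMoment_two_eq, hm]
  norm_num
  ring

theorem tendsto_walkMoment_two_div_mul_two_pow {m : ℝ} (hm : m ^ 2 = 1 / 2) :
    Tendsto (fun n : ℕ => walkMoment m n 2 / (n * 2 ^ n)) atTop (𝓝 (1 / 2)) := by
  have hlim : Tendsto (fun n : ℕ => 1 / (n : ℝ) + 1 / 2) atTop (𝓝 (1 / 2)) := by
    simpa using tendsto_one_div_atTop_nhds_zero_nat.add_const (1 / 2 : ℝ)
  refine hlim.congr' ?_
  filter_upwards [eventually_ne_atTop 0] with n hn
  rw [walkMoment_two_of_sq_eq_half hm]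
  field_simp

theorem sq_two_rpow_sub_one (h : ℝ) : ((2 : ℝ) ^ (h - 1)) ^ 2 = 2 ^ (2 * h - 1) / 2 := by
  rw [← Real.rpow_natCast, ← Real.rpow_mul zero_le_two, ← Real.rpow_sub_one two_ne_zero]
  congr 1
  push_cast
  ring

theorem sigma_sq_of_lt {h : ℝ} (hh : h < 1 / 2) :
    sigma h ^ 2 = 1 + ((2 : ℝ) ^ (h - 1)) ^ 2 * (1 - 2 * ((2 : ℝ) ^ (h - 1)) ^ 2)⁻¹ := by
  have hr1 : (2 : ℝ) ^ (2 * h - 1) < 1 :=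
    Real.rpow_lt_one_of_one_lt_of_neg one_lt_two (by linarith)
  have hexp : (2 : ℝ) ^ (2 - 2 * h) = 2 / 2 ^ (2 * h - 1) := by
    rw [eq_div_iff (by positivity), ← Real.rpow_add two_pos]
    norm_num
  rw [sigma, if_pos hh, hexp, sq_two_rpow_sub_one]
  set r : ℝ := 2 ^ (2 * h - 1)
  have hr : 0 < r := by positivity
  have hinv : (2 / r - 2)⁻¹ = r / 2 * (1 - 2 * (r / 2))⁻¹ := by
    rw [mul_div_cancel₀ r two_ne_zero, show 2 / r - 2 = 2 * (1 - r) / r by field_simp, inv_div,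
      div_mul_eq_div_div, div_eq_mul_inv]
  rw [hinv, Real.sq_sqrt]
  have : 0 < 1 - 2 * (r / 2) := by linarith
  positivity

theorem two_rpow_mul_two_rpow_eq_sqrt (n : ℕ) (h : ℝ) :
    (2 : ℝ) ^ (n * (1 / 2 - h)) * 2 ^ (n * h) = √(2 ^ n) := by
  rw [← Real.rpow_add two_pos, ← mul_add, sub_add_cancel, Real.rpow_mul zero_le_two,
    Real.rpow_natCast, Real.sqrt_eq_rpow]

theorem normalizedReal_of_lt {h : ℝ} (hh : h < 1 / 2) (e : List Bool → ℝ) (n : ℕ) :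
    normalizedReal h e n = (sigma h * √(2 ^ n))⁻¹ • interp e n := by
  rw [normalizedReal, if_pos hh, cascade, smul_smul, Real.rpow_neg zero_le_two, ← mul_inv,
    mul_assoc, two_rpow_mul_two_rpow_eq_sqrt]

theorem normalizedReal_half (e : List Bool → ℝ) (n : ℕ) :
    normalizedReal (1 / 2) e n = (sigma (1 / 2) * √(n * 2 ^ n))⁻¹ • interp e n := by
  have hsqrt := two_rpow_mul_two_rpow_eq_sqrt n (1 / 2)
  rw [sub_self, mul_zero, Real.rpow_zero, one_mul] at hsqrt
  rw [normalizedReal, if_neg (lt_irrefl _), cascade, smul_smul, Real.rpow_neg zero_le_two,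
    ← mul_inv, hsqrt, mul_assoc, Real.sqrt_mul n.cast_nonneg]

theorem sq_signMean_le {H : EReal} (hH : H ≤ ((1 / 2 : ℝ) : EReal)) : signMean H ^ 2 ≤ 1 / 2 := by
  induction H with
  | bot => simp [signMean]
  | top => exact absurd hH (by simp)
  | coe h =>
    have hh : h ≤ 1 / 2 := by exact_mod_cast hH
    rw [signMean, if_neg (EReal.coe_ne_bot _), EReal.toReal_coe, sq_two_rpow_sub_one]
    gcongr
    exact Real.rpow_le_one_of_one_le_of_nonpos one_le_two (by linarith)

theorem tendsto_inv_sigma_mul_sqrt_of_lt {h : ℝ} (hh : h < 1 / 2) :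
    Tendsto (fun n => (sigma h * √(2 ^ n))⁻¹ ^ 2 * walkMoment (2 ^ (h - 1)) n 2) atTop (𝓝 1) := by
  have hm : ((2 : ℝ) ^ (h - 1)) ^ 2 < 1 / 2 := by
    rw [sq_two_rpow_sub_one]
    gcongr
    exact Real.rpow_lt_one_of_one_lt_of_neg one_lt_two (by linarith)
  have hlim := tendsto_walkMoment_two_div_two_pow hm
  rw [← sigma_sq_of_lt hh] at hlim
  have hσ : sigma h ^ 2 ≠ 0 := by
    have : 0 < 1 - 2 * ((2 : ℝ) ^ (h - 1)) ^ 2 := by linarith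
    rw [sigma_sq_of_lt hh]
    positivity
  have hratio := hlim.div_const (sigma h ^ 2)
  rw [div_self hσ] at hratio
  refine hratio.congr fun n => ?_
  rw [inv_pow, mul_pow, Real.sq_sqrt (by positivity)]
  field_simp

theorem tendsto_inv_sigma_mul_sqrt_half :
    Tendsto (fun n : ℕ => (sigma (1 / 2) * √(n * 2 ^ n))⁻¹ ^ 2 *
      walkMoment (2 ^ ((1 / 2 : ℝ) - 1)) n 2) atTop (𝓝 1) := by
  have hm : ((2 : ℝ) ^ ((1 / 2 : ℝ) - 1)) ^ 2 = 1 / 2 := by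
    rw [sq_two_rpow_sub_one]
    norm_num
  have hσ : sigma (1 / 2) ^ 2 = 1 / 2 := by
    rw [sigma, if_neg (lt_irrefl _), div_pow, one_pow, Real.sq_sqrt zero_le_two]
  have hratio := (tendsto_walkMoment_two_div_mul_two_pow hm).div_const (1 / 2)
  rw [div_self (by norm_num)] at hratio
  refine hratio.congr fun n => ?_
  rw [inv_pow, mul_pow, hσ, Real.sq_sqrt (by positivity), mul_inv, div_div_eq_mul_div]
  ring

theorem exists_normalized_eq_smul {H : EReal} (hH : H ≤ ((1 / 2 : ℝ) : EReal)) :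
    ∃ c : ℕ → ℝ, (∀ e n, normalized H e n = c n • interp e n) ∧
      Tendsto (fun n => c n ^ 2 * walkMoment (signMean H) n 2) atTop (𝓝 1) := by
  induction H with
  | bot =>
    refine ⟨fun n => (√(2 ^ n))⁻¹, fun e n => by rw [normalized, if_pos rfl],
      tendsto_const_nhds.congr fun n => ?_⟩
    rw [signMean, if_pos rfl, walkMoment_two_eq, inv_pow, Real.sq_sqrt (by positivity)]
    simp
  | top => exact absurd hH (by simp)
  | coe h =>
    have hh : h ≤ 1 / 2 := by exact_mod_cast hH
    simp only [normalized, signMean, if_neg (EReal.coe_ne_bot h), EReal.toReal_coe]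
    rcases hh.lt_or_eq with hlt | rfl
    · exact ⟨_, normalizedReal_of_lt hlt, tendsto_inv_sigma_mul_sqrt_of_lt hlt⟩
    · exact ⟨_, normalizedReal_half, tendsto_inv_sigma_mul_sqrt_half⟩

end Normalization

/-! ### The law of the signs -/

section SignLaw

variable {Ω : Type*} [MeasurableSpace Ω] {P : Measure Ω}

theorem measurableSet_eq_one_or : MeasurableSet {x : ℝ | x = 1 ∨ x = -1} :=
  (measurableSet_singleton 1).union (measurableSet_singleton (-1))

theorem ae_eq_one_or_of_hasLaw_signLaw {H : EReal} {X : Ω → ℝ} (hX : HasLaw X (signLaw H) P) :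
    ∀ᵐ ω ∂P, X ω = 1 ∨ X ω = -1 := by
  rw [hX.ae_iff (p := fun x => x = 1 ∨ x = -1) (measurableSet_setOfPred.1 measurableSet_eq_one_or)]
  exact ae_add_measure_iff.2
    ⟨Measure.ae_smul_measure ((ae_dirac_iff measurableSet_eq_one_or).2 (Or.inl rfl)) _,
      Measure.ae_smul_measure ((ae_dirac_iff measurableSet_eq_one_or).2 (Or.inr rfl)) _⟩

theorem integral_of_hasLaw_signLaw {H : EReal} (hH : H ≤ ((1 / 2 : ℝ) : EReal)) {X : Ω → ℝ}
    (hX : HasLaw X (signLaw H) P) : ∫ ω, X ω ∂P = signMean H := by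
  have hmean : |signMean H| ≤ 1 := by
    rw [← sq_le_one_iff_abs_le_one]
    linarith [sq_signMean_le hH]
  have hint (a x : ℝ) : Integrable (fun y : ℝ => y) (ENNReal.ofReal a • Measure.dirac x) :=
    (integrable_dirac (by simp)).smul_measure ENNReal.ofReal_ne_top
  rw [abs_le] at hmean
  rw [hX.integral_eq, signLaw, integral_add_measure (hint _ _) (hint _ _), integral_smul_measure,
    integral_smul_measure, integral_dirac, integral_dirac, ENNReal.toReal_ofReal (by linarith),
    ENNReal.toReal_ofReal (by linarith), smul_eq_mul, smul_eq_mul]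
  ring

theorem exists_isSignFamily_ae_eq {m : ℝ} {ε : List Bool → Ω → ℝ} (hindep : iIndepFun ε P)
    (hmeas : ∀ w, AEMeasurable (ε w) P) (hsign : ∀ w, ∀ᵐ ω ∂P, ε w ω = 1 ∨ ε w ω = -1)
    (hmean : ∀ w, ∫ ω, ε w ω ∂P = m) :
    ∃ ε' : List Bool → Ω → ℝ, IsSignFamily P m ε' ∧ ∀ w, ε' w =ᵐ[P] ε w := by
  classical
  let ε' (w : List Bool) (ω : Ω) : ℝ := if (hmeas w).mk (ε w) ω = 1 then 1 else -1
  have hae (w : List Bool) : ε' w =ᵐ[P] ε w := by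
    filter_upwards [hsign w, (hmeas w).ae_eq_mk] with ω hω hmk
    rcases hω with hω | hω <;> norm_num [ε', ← hmk, hω]
  refine ⟨ε', ⟨fun w => ?_, hindep.congr fun w => (hae w).symm, fun w ω => ?_, fun w => ?_⟩, hae⟩
  · exact Measurable.ite ((hmeas w).measurable_mk (measurableSet_singleton 1))
      measurable_const measurable_const
  · exact ite_eq_or_eq _ _ _
  · rw [integral_congr_ae (hae w), hmean]

end SignLaw

end SignedCascade

end

theorem theorem3_general {Ω : Type*} [MeasurableSpace Ω] (P : Measure Ω) [IsProbabilityMeasure P]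
    (m : ℝ) (hm : m ^ 2 ≤ 1 / 2) (ε : List Bool → Ω → ℝ) (hε_indep : iIndepFun ε P)
    (hε_meas : ∀ w, AEMeasurable (ε w) P)
    (hε_sign : ∀ w, ∀ᵐ ω ∂P, ε w ω = 1 ∨ ε w ω = -1) (hε_mean : ∀ w, ∫ ω, ε w ω ∂P = m)
    (c : ℕ → ℝ) (hc : Tendsto (fun n => c n ^ 2 * SignedCascade.walkMoment m n 2) atTop (𝓝 1)) :
    ∃ W : ProbabilityMeasure C(unitInterval, ℝ),
      SignedCascade.IsWienerMeasure (W : Measure C(unitInterval, ℝ)) ∧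
      TendstoInDistribution
        (fun (n : ℕ) (ω : Ω) => c n • SignedCascade.interp (fun w => ε w ω) n)
        atTop (fun f : C(unitInterval, ℝ) => f) (fun _ => P)
        (W : Measure C(unitInterval, ℝ)) := by
  obtain ⟨ε', hε', hae⟩ :=
    SignedCascade.exists_isSignFamily_ae_eq hε_indep hε_meas hε_sign hε_mean
  obtain ⟨W, hW, hlim⟩ := hε'.exists_isWienerMeasure_tendstoInDistribution hm hc
  refine ⟨W, hW, hlim.congr (fun n => ?_) EventuallyEq.rfl⟩
  filter_upwards [ae_all_iff.2 hae] with ω hω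
  simp only [hω]

theorem theorem3 {Ω : Type*} [MeasurableSpace Ω] (P : Measure Ω) [IsProbabilityMeasure P]
    (H : EReal) (hH : H ≤ ((1 / 2 : ℝ) : EReal))
    (ε : List Bool → Ω → ℝ)
    (hε_indep : iIndepFun ε P)
    (hε_law : ∀ w : List Bool, HasLaw (ε w) (SignedCascade.signLaw H) P) :
    ∃ W : ProbabilityMeasure C(unitInterval, ℝ),
      SignedCascade.IsWienerMeasure (W : Measure C(unitInterval, ℝ)) ∧
      TendstoInDistribution
        (fun (n : ℕ) (ω : Ω) => SignedCascade.normalized H (fun w => ε w ω) n)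
        atTop (fun f : C(unitInterval, ℝ) => f) (fun _ => P)
        (W : Measure C(unitInterval, ℝ)) := by
  obtain ⟨c, hc, hlim⟩ := SignedCascade.exists_normalized_eq_smul hH
  simpa only [hc] using theorem3_general P _ (SignedCascade.sq_signMean_le hH) ε hε_indep
    (fun w => (hε_law w).aemeasurable)
    (fun w => SignedCascade.ae_eq_one_or_of_hasLaw_signLaw (hε_law w))
    (fun w => SignedCascade.integral_of_hasLaw_signLaw hH (hε_law w)) c hlim
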